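/- Let $\mathbb F\in\{\mathbb R,\mathbb C\}$, $d\ge 0$, $N\ge 2$, $a\ge 0$, and let $\Sigma\in\mathbb F^{d\times d}$ be positive semi-definite (for instance diagonal with non-negative entries), with positive semi-definite square root $\Sigma^{1/2}$. Let $W_1(t),\dots,W_N(t)\in\mathbb F^{d\times d}$, $t\in[0,\infty)$, follow the gradient flow $\frac{\mathrm d W_j}{\mathrm dt}=-\nabla_{W_j}\mathcal L$ of $$\mathcal L(W_1,\dots,W_N)=\tfrac12\|\Sigma-W_N\cdots W_1\|_F^2+\tfrac a4\sum_{j=1}^{N-1}\|W_jW_j^H-W_{j+1}^HW_{j+1}\|_F^2 ,$$ where gradients are taken with respect to the real inner product $\Re\,\mathrm{tr}(A^HB)$, and assume that the initialization is balanced: $W_j(0)W_j(0)^H=W_{j+1}(0)^HW_{j+1}(0)$ for $1\le j\le N-1$. Put $W(t)=W_N(t)\cdots W_1(t)$ and let $W(t)=U(t)\Sigma_w(t)^NV(t)^H$, $t\ge 0$, be a non-negative analytic singular value decomposition: $U(t),V(t)$ are unitary (orthogonal if $\mathbb F=\mathbb R$), $\Sigma_w(t)$ is diagonal with real entries $\sigma_{w,j}(t)\ge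 0$ (in any order), and $U$, $V$ and $\Sigma_w^N$ are real analytic in $t\in[0,\infty)$. Assume that the singular values $\sigma_{w,j}(0)^N$ of $W(0)$ are distinct and different from zero. Let $u_j'$ and $v_j'$ be the $j$-th columns of $\Sigma^{1/2}U$ and $\Sigma^{1/2}V$, and for $x,y\ge0$ put $$f_N(x,y)=\begin{cases}\dfrac{x^2y^2(x^{N-2}-y^{N-2})}{x^2-y^2}, & y\ne x,\\[2mm] \dfrac{N-2}{2}\,x^N, & y=x.\end{cases}$$ Then for every $t\ge 0$ (with a one-sided derivative at $t=0$) $$\begin{aligned}\frac{\mathrm d}{\mathrm dt}\|\Sigma^{1/2}(U-V)\Sigma_w\|_F^2={}&-2\sum_j\sigma_{w,j}^N\,\|\Sigma^{1/2}(u_j'-v_j')\|^2-2\sum_j\sigma_{w,j}^{2N}\,\|u_j'-v_j'\|^2\\&-\sum_{j,k}f_N(\sigma_{w,j},\sigma_{w,k})\,\bigl|u_j'^Hv_k'-v_j'^Hu_k'\bigr|^2\;\le\;0,\end{aligned}$$ so $\|\Sigma^{1/2}(U-V)\Sigma_w\|_F^2$ is non-increasing on $[0,\infty)$. Moreover $f_N$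 is non-negative and continuous on $[0,\infty)^2$ and real analytic on $[0,\infty)^2\setminus\{(0,0)\}$; if $N$ is even, it is real analytic on all of $[0,\infty)^2$. -/

import Mathlib

open Matrix Set
open scoped MatrixOrder ComplexOrder

namespace DeepMF

variable {𝕜 : Type*} [RCLike 𝕜] {d : ℕ}

/-- The squared Frobenius norm `‖A‖_F ^ 2`. -/
noncomputable def frobSq (A : Matrix (Fin d) (Fin d) 𝕜) : ℝ :=
  ∑ i, ∑ j, ‖A i j‖ ^ 2

/-- The product `W_k W_{k-1} ⋯ W_1` of the first `k` layers. The layers are numbered from `1`;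
the value `W 0` is never used. -/
noncomputable def layerProd (W : ℕ → Matrix (Fin d) (Fin d) 𝕜) : ℕ → Matrix (Fin d) (Fin d) 𝕜
  | 0 => 1
  | k + 1 => W (k + 1) * layerProd W k

/-- The balance error `Δ_{j,j+1} = W_j W_jᴴ - W_{j+1}ᴴ W_{j+1}`. -/
noncomputable def balanceError (W : ℕ → Matrix (Fin d) (Fin d) 𝕜) (j : ℕ) :
    Matrix (Fin d) (Fin d) 𝕜 :=
  W j * (W j)ᴴ - (W (j + 1))ᴴ * W (j + 1)

/-- The layers `W_1, …, W_N` are balanced: `W_j W_jᴴ = W_{j+1}ᴴ W_{j+1}` for `1 ≤ j ≤ N - 1`. -/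
def IsBalanced (N : ℕ) (W : ℕ → Matrix (Fin d) (Fin d) 𝕜) : Prop :=
  ∀ j ∈ Finset.Ico 1 N, balanceError W j = 0

/-- The square loss with balance regularization,
`L = (1/2) ‖T - W_N ⋯ W_1‖_F ^ 2 + (a/4) ∑_{j=1}^{N-1} ‖Δ_{j,j+1}‖_F ^ 2`, for the target `T`. -/
noncomputable def loss (N : ℕ) (T : Matrix (Fin d) (Fin d) 𝕜) (a : ℝ)
    (W : ℕ → Matrix (Fin d) (Fin d) 𝕜) : ℝ :=
  1 / 2 * frobSq (T - layerProd W N) +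
    a / 4 * ∑ j ∈ Finset.Ico 1 N, frobSq (balanceError W j)

/-- `G` is the gradient of the real-valued function `f` at `X`, with respect to the real inner
product `⟨A, B⟩ = Re tr (Aᴴ B)` on matrices: the derivative of `f` at `X` in every direction `H`
is `⟨G, H⟩`. -/
def IsMatrixGradient (f : Matrix (Fin d) (Fin d) 𝕜 → ℝ) (X G : Matrix (Fin d) (Fin d) 𝕜) : Prop :=
  ∀ H : Matrix (Fin d) (Fin d) 𝕜,
    HasDerivAt (fun s : ℝ => f (X + s • H)) (RCLike.re (Gᴴ * H).trace) 0

/-- `W` is a gradient flow trajectory of the loss on `[0, ∞)`: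
`dW_j/dt = -∇_{W_j} L (W_1, …, W_N)` for `1 ≤ j ≤ N` (with a one-sided derivative at `t = 0`). -/
def IsGradientFlow (N : ℕ) (T : Matrix (Fin d) (Fin d) 𝕜) (a : ℝ)
    (W : ℝ → ℕ → Matrix (Fin d) (Fin d) 𝕜) : Prop :=
  ∀ t ∈ Ici (0 : ℝ), ∀ j ∈ Finset.Icc 1 N, ∃ G : Matrix (Fin d) (Fin d) 𝕜,
    IsMatrixGradient (fun X => loss N T a (Function.update (W t) j X)) (W t j) G ∧
    ∀ p q, HasDerivWithinAt (fun s => W s j p q) (-(G p q)) (Ici 0) t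

/-- The diagonal matrix `Σ_w` with the real diagonal entries `σ j`. -/
noncomputable def diagReal (𝕜 : Type*) [RCLike 𝕜] {d : ℕ} (σ : Fin d → ℝ) :
    Matrix (Fin d) (Fin d) 𝕜 :=
  Matrix.diagonal fun j => (σ j : 𝕜)

/-- `M = U Σ_w ^ N Vᴴ` is a non-negative analytic singular value decomposition of the matrix curve
`M` on `[0, ∞)`: `U` and `V` are unitary (orthogonal for `𝕜 = ℝ`), `Σ_w` is diagonal with
non-negative entries `σ t j`, and `U`, `V` and the diagonal `Σ_w ^ N` of singular values are real
analytic in `t`. The singular values may come in any order. -/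
structure IsNonnegASVD (N : ℕ) (M U V : ℝ → Matrix (Fin d) (Fin d) 𝕜) (σ : ℝ → Fin d → ℝ) :
    Prop where
  unitary_left : ∀ t ∈ Ici (0 : ℝ), U t ∈ Matrix.unitaryGroup (Fin d) 𝕜
  unitary_right : ∀ t ∈ Ici (0 : ℝ), V t ∈ Matrix.unitaryGroup (Fin d) 𝕜
  nonneg : ∀ t ∈ Ici (0 : ℝ), ∀ j, 0 ≤ σ t j
  analytic_left : ∀ i j, AnalyticOn ℝ (fun t => U t i j) (Ici 0)
  analytic_right : ∀ i j, AnalyticOn ℝ (fun t => V t i j) (Ici 0)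
  analytic_diag : ∀ j, AnalyticOn ℝ (fun t => σ t j ^ N) (Ici 0)
  decomp : ∀ t ∈ Ici (0 : ℝ), M t = U t * diagReal 𝕜 (σ t) ^ N * (V t)ᴴ

/-- `f_N (x, y) = x² y² (x^(N-2) - y^(N-2)) / (x² - y²)` for `y ≠ x`, and
`f_N (x, x) = (N - 2)/2 · x^N` (used for `N ≥ 2` and `x, y ≥ 0`). -/
noncomputable def fN (N : ℕ) (x y : ℝ) : ℝ :=
  if y = x then ((N : ℝ) - 2) / 2 * x ^ N
  else x ^ 2 * y ^ 2 * (x ^ (N - 2) - y ^ (N - 2)) / (x ^ 2 - y ^ 2)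

/-- The skew-Hermitian error `‖T^{1/2} (U - V) Σ_w‖_F ^ 2`. -/
noncomputable def skewError (T U V : Matrix (Fin d) (Fin d) 𝕜) (σ : Fin d → ℝ) : ℝ :=
  frobSq (CFC.sqrt T * (U - V) * diagReal 𝕜 σ)

/-- The `j`-th column `u'_j` of `U' = T^{1/2} U`. -/
noncomputable def primedCol (T U : Matrix (Fin d) (Fin d) 𝕜) (j : Fin d) : Fin d → 𝕜 :=
  (CFC.sqrt T * U).col j

/-- The right-hand side of the formula for the derivative of the skew-Hermitian error, with
`u'_j = primedCol T U j` and `v'_j = primedCol T V j`. The vector norms are Euclidean, and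
`star x ⬝ᵥ y` is `xᴴ y`. -/
noncomputable def skewErrorRate (N : ℕ) (T U V : Matrix (Fin d) (Fin d) 𝕜) (σ : Fin d → ℝ) : ℝ :=
  -(2 * (∑ j, σ j ^ N *
      ‖WithLp.toLp 2 (CFC.sqrt T *ᵥ (primedCol T U j - primedCol T V j))‖ ^ 2))
    - 2 * (∑ j, σ j ^ (2 * N) * ‖WithLp.toLp 2 (primedCol T U j - primedCol T V j)‖ ^ 2)
    - (∑ j, ∑ k, fN N (σ j) (σ k) *
        ‖star (primedCol T U j) ⬝ᵥ primedCol T V k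
          - star (primedCol T V j) ⬝ᵥ primedCol T U k‖ ^ 2)

end DeepMF

/-!
The statement is proved by reading the flow in the moving singular frame of `W = W_N ⋯ W_1`.

*Reduction to a flow of `W`.* The gradients of the square loss and of the balance regularizer are
orthogonal, because the square loss is invariant under `W_j ↦ g_j W_j g_{j-1}⁻¹`
(`sum_re_trace_balanceGradient_mul_descentDirection`). Hence the regularizer does not increase along
the flow, and a balanced initialization stays balanced (`IsGradientFlow.isBalanced`). Partial products
of balanced layers have Gram matrices that are powers of `W_N W_Nᴴ` and `W_1ᴴ W_1`; by uniqueness of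
roots of positive semidefinite matrices these are `U Σ_w² Uᴴ` and `V Σ_w² Vᴴ`. So `W'` is a sum of
residuals `T - W` with powers of these on both sides.

*The singular frame.* With `A = Uᴴ U'`, `B = Vᴴ V'`, `P = Uᴴ T V` and `S = Σ_w ^ N`, the equation for
`W'` becomes `A S - S B + S' = ∑_l Σ_w^(2(N-1-l)) (P - S) Σ_w^(2l)` (`IsNonnegASVD.isFrameFlow`). Its
diagonal shows that singular values that start positive stay positive (`IsNonnegASVD.pos`). Combined
with its adjoint it determines the commutators of `A` and `B` with `Σ_w²` and the anticommutator of
`A - B` with `Σ_w²` (`IsFrameFlow.left_commutator`, `IsFrameFlow.right_commutator`,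
`IsFrameFlow.anticommutator`). The derivative of the error involves the frame velocities only through
these three matrices, so no division by differences of singular values occurs, and instants at which
singular values cross need no separate treatment. The rest is a trace computation
(`IsFrameFlow.re_trace_deriv`).

*The weight.* On the closed quadrant, `fN N x y = x² y² (∑_i x^i y^(N-3-i)) / (x + y)`
(`fN_eq_geom_sum_div`), from which sign, continuity and analyticity are read off.
-/

namespace DeepMF

variable {𝕜 : Type*} [RCLike 𝕜] {d : ℕ}

/-! ### The weight function `fN` -/

/-- On the closed quadrant the removable singularity of `fN` along the diagonal is absent from
this expression; at the origin both sides vanish, the right-hand side as a quotient by `0`. -/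
lemma fN_eq_geom_sum_div {N : ℕ} (hN : 2 ≤ N) {x y : ℝ} (hx : 0 ≤ x) (hy : 0 ≤ y) :
    fN N x y = x ^ 2 * y ^ 2 *
      (∑ i ∈ Finset.range (N - 2), x ^ i * y ^ (N - 2 - 1 - i)) / (x + y) := by
  obtain ⟨n, rfl⟩ : ∃ n, N = n + 2 := ⟨N - 2, by omega⟩
  unfold fN
  simp only [Nat.add_sub_cancel]
  split_ifs with h
  · subst h
    rcases hy.eq_or_lt with h0 | h0
    · simp [← h0]
    · rw [geom_sum₂_self]
      rcases n with _ | n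
      · simp
      · simp only [Nat.add_sub_cancel]
        push_cast
        field_simp
        ring
  · have hxy : x - y ≠ 0 := sub_ne_zero.mpr (Ne.symm h)
    have hs : x + y ≠ 0 := by
      intro h0
      apply h
      linarith
    rw [← geom_sum₂_mul, show x ^ 2 - y ^ 2 = (x + y) * (x - y) by ring]
    field_simp

lemma fN_nonneg {N : ℕ} (hN : 2 ≤ N) {x y : ℝ} (hx : 0 ≤ x) (hy : 0 ≤ y) : 0 ≤ fN N x y := by
  rw [fN_eq_geom_sum_div hN hx hy]
  positivity

lemma analyticOn_fN {N : ℕ} (hN : 2 ≤ N) :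
    AnalyticOn ℝ (fun p : ℝ × ℝ => fN N p.1 p.2) ((Ici 0 ×ˢ Ici 0) \ {(0, 0)}) := by
  have h : AnalyticOn ℝ (fun p : ℝ × ℝ => p.1 ^ 2 * p.2 ^ 2 *
      (∑ i ∈ Finset.range (N - 2), p.1 ^ i * p.2 ^ (N - 2 - 1 - i)) / (p.1 + p.2))
      ((Ici 0 ×ˢ Ici 0) \ {(0, 0)}) := by
    have h1 : AnalyticOn ℝ (fun p : ℝ × ℝ => p.1) ((Ici 0 ×ˢ Ici 0) \ {(0, 0)}) :=
      analyticOn_fst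
    have h2 : AnalyticOn ℝ (fun p : ℝ × ℝ => p.2) ((Ici 0 ×ˢ Ici 0) \ {(0, 0)}) :=
      analyticOn_snd
    refine AnalyticOn.div (((h1.pow 2).mul (h2.pow 2)).mul ?_) (h1.add h2) ?_
    · exact Finset.analyticOn_fun_sum _ fun i _ => (h1.pow i).mul (h2.pow _)
    · rintro ⟨x, y⟩ ⟨⟨hx, hy⟩, hne⟩ h0
      simp only [mem_Ici] at hx hy h0
      exact hne (by simp only [mem_singleton_iff, Prod.mk.injEq]; constructor <;> linarith)
  exact h.congr fun p hp => fN_eq_geom_sum_div hN hp.1.1 hp.1.2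

lemma analyticOn_fN_of_even {N : ℕ} (hN : 2 ≤ N) (he : Even N) :
    AnalyticOn ℝ (fun p : ℝ × ℝ => fN N p.1 p.2) (Ici 0 ×ˢ Ici 0) := by
  obtain ⟨m, hm⟩ : ∃ m, N = 2 * m + 2 := by
    obtain ⟨k, rfl⟩ := he
    exact ⟨k - 1, by omega⟩
  subst hm
  -- For even `N` the factor `x + y` divides the numerator, and `fN` is a polynomial in `x²`, `y²`.
  have key : ∀ p ∈ (Ici 0 ×ˢ Ici 0 : Set (ℝ × ℝ)), fN (2 * m + 2) p.1 p.2 = p.1 ^ 2 * p.2 ^ 2 *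
      (∑ i ∈ Finset.range m, (p.1 ^ 2) ^ i * (p.2 ^ 2) ^ (m - 1 - i)) := by
    rintro ⟨x, y⟩ ⟨hx, hy⟩
    simp only [mem_Ici] at hx hy ⊢
    unfold fN
    simp only [Nat.add_sub_cancel]
    split_ifs with h
    · subst h
      rw [geom_sum₂_self]
      rcases m with _ | m
      · simp
      · simp only [Nat.add_sub_cancel]
        push_cast
        ring
    · have hxy : x ^ 2 - y ^ 2 ≠ 0 := by
        rw [sub_ne_zero, Ne, sq_eq_sq₀ hx hy]
        exact Ne.symm h
      rw [pow_mul, pow_mul, ← geom_sum₂_mul]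
      field_simp
  have h1 : AnalyticOn ℝ (fun p : ℝ × ℝ => p.1) (Ici 0 ×ˢ Ici 0) := analyticOn_fst
  have h2 : AnalyticOn ℝ (fun p : ℝ × ℝ => p.2) (Ici 0 ×ˢ Ici 0) := analyticOn_snd
  refine AnalyticOn.congr (((h1.pow 2).mul (h2.pow 2)).mul ?_) key
  exact Finset.analyticOn_fun_sum _ fun i _ => ((h1.pow 2).pow i).mul ((h2.pow 2).pow _)

lemma continuousOn_fN {N : ℕ} (hN : 2 ≤ N) :
    ContinuousOn (fun p : ℝ × ℝ => fN N p.1 p.2) (Ici 0 ×ˢ Ici 0) := by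
  intro p hp
  by_cases h0 : p = (0, 0)
  · subst h0
    -- Near the origin, `x² y² / (x + y) ≤ x y²`.
    have hb : ∀ q ∈ (Ici 0 ×ˢ Ici 0 : Set (ℝ × ℝ)), fN N q.1 q.2 ≤ q.1 * q.2 ^ 2 *
        (∑ i ∈ Finset.range (N - 2), q.1 ^ i * q.2 ^ (N - 2 - 1 - i)) := by
      rintro ⟨x, y⟩ ⟨hx, hy⟩
      simp only [mem_Ici] at hx hy ⊢
      rw [fN_eq_geom_sum_div hN hx hy]
      have hS : 0 ≤ ∑ i ∈ Finset.range (N - 2), x ^ i * y ^ (N - 2 - 1 - i) := by positivity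
      refine div_le_of_le_mul₀ (by positivity) (by positivity) ?_
      have : 0 ≤ x * y ^ 3 * ∑ i ∈ Finset.range (N - 2), x ^ i * y ^ (N - 2 - 1 - i) := by
        positivity
      nlinarith
    have hz : fN N 0 0 = 0 := by
      simp [fN_eq_geom_sum_div hN le_rfl le_rfl]
    rw [ContinuousWithinAt, hz]
    refine tendsto_of_tendsto_of_tendsto_of_le_of_le' tendsto_const_nhds (h := fun q : ℝ × ℝ =>
      q.1 * q.2 ^ 2 * (∑ i ∈ Finset.range (N - 2), q.1 ^ i * q.2 ^ (N - 2 - 1 - i))) ?_ ?_ ?_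
    · have hc : Continuous fun q : ℝ × ℝ =>
          q.1 * q.2 ^ 2 * (∑ i ∈ Finset.range (N - 2), q.1 ^ i * q.2 ^ (N - 2 - 1 - i)) := by
        fun_prop
      simpa using (hc.tendsto (0, 0)).mono_left nhdsWithin_le_nhds
    · filter_upwards [self_mem_nhdsWithin] with q hq using fN_nonneg hN hq.1 hq.2
    · filter_upwards [self_mem_nhdsWithin] with q hq using hb q hq
  · have hc := (analyticOn_fN hN).continuousOn p ⟨hp, h0⟩
    refine hc.mono_of_mem_nhdsWithin ?_
    exact inter_mem_nhdsWithin _ (isOpen_compl_singleton.mem_nhds h0)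

/-! ### Entrywise derivatives of matrix curves -/

/-- The matrix curve `M` has derivative `M'` at `t` within `s`, entry by entry. -/
def HasEntryDerivWithinAt (M : ℝ → Matrix (Fin d) (Fin d) 𝕜) (M' : Matrix (Fin d) (Fin d) 𝕜)
    (s : Set ℝ) (t : ℝ) : Prop :=
  ∀ i j, HasDerivWithinAt (fun τ => M τ i j) (M' i j) s t

namespace HasEntryDerivWithinAt

variable {M L : ℝ → Matrix (Fin d) (Fin d) 𝕜} {M' L' : Matrix (Fin d) (Fin d) 𝕜}
  {s : Set ℝ} {t : ℝ}

lemma const (A : Matrix (Fin d) (Fin d) 𝕜) : HasEntryDerivWithinAt (fun _ => A) 0 s t :=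
  fun i j => by simpa using hasDerivWithinAt_const t s (A i j)

lemma add (hM : HasEntryDerivWithinAt M M' s t) (hL : HasEntryDerivWithinAt L L' s t) :
    HasEntryDerivWithinAt (fun τ => M τ + L τ) (M' + L') s t :=
  fun i j => (hM i j).add (hL i j)

lemma sub (hM : HasEntryDerivWithinAt M M' s t) (hL : HasEntryDerivWithinAt L L' s t) :
    HasEntryDerivWithinAt (fun τ => M τ - L τ) (M' - L') s t :=
  fun i j => (hM i j).sub (hL i j)

lemma mul (hM : HasEntryDerivWithinAt M M' s t) (hL : HasEntryDerivWithinAt L L' s t) :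
    HasEntryDerivWithinAt (fun τ => M τ * L τ) (M' * L t + M t * L') s t := fun i j => by
  simp only [Matrix.mul_apply, Matrix.add_apply, ← Finset.sum_add_distrib]
  exact HasDerivWithinAt.fun_sum fun k _ => (hM i k).mul (hL k j)

lemma conjTranspose (hM : HasEntryDerivWithinAt M M' s t) :
    HasEntryDerivWithinAt (fun τ => (M τ)ᴴ) M'ᴴ s t := fun i j => by
  simpa only [Matrix.conjTranspose_apply] using (hM j i).star

lemma re_trace (hM : HasEntryDerivWithinAt M M' s t) :
    HasDerivWithinAt (fun τ => RCLike.re (M τ).trace) (RCLike.re M'.trace) s t := by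
  have h : HasDerivWithinAt (fun τ => (M τ).trace) M'.trace s t :=
    HasDerivWithinAt.fun_sum fun k _ => hM k k
  exact (RCLike.reCLM (K := 𝕜)).hasFDerivAt.comp_hasDerivWithinAt t h

lemma congr (hM : HasEntryDerivWithinAt M M' s t) (h : ∀ τ ∈ s, L τ = M τ) (ht : t ∈ s) :
    HasEntryDerivWithinAt L M' s t := fun i j =>
  (hM i j).congr (fun τ hτ => by rw [h τ hτ]) (by rw [h t ht])

lemma congr_deriv (hM : HasEntryDerivWithinAt M M' s t) (h : M' = L') :
    HasEntryDerivWithinAt M L' s t := h ▸ hM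

lemma unique (hM : HasEntryDerivWithinAt M M' s t) (hL : HasEntryDerivWithinAt M L' s t)
    (hs : UniqueDiffWithinAt ℝ s t) : M' = L' := by
  ext i j
  exact hs.eq_deriv _ (hM i j) (hL i j)

end HasEntryDerivWithinAt

lemma re_trace_conjTranspose (A : Matrix (Fin d) (Fin d) 𝕜) :
    RCLike.re (Aᴴ).trace = RCLike.re A.trace := by
  rw [Matrix.trace_conjTranspose]
  exact RCLike.conj_re _

lemma frobSq_eq_re_trace (A : Matrix (Fin d) (Fin d) 𝕜) :
    frobSq A = RCLike.re (Aᴴ * A).trace := by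
  simp only [frobSq, Matrix.trace, Matrix.diag_apply, Matrix.mul_apply,
    Matrix.conjTranspose_apply, map_sum]
  rw [Finset.sum_comm]
  refine Finset.sum_congr rfl fun i _ => Finset.sum_congr rfl fun j _ => ?_
  rw [RCLike.star_def, RCLike.conj_mul, ← RCLike.ofReal_pow, RCLike.ofReal_re]

lemma frobSq_nonneg (A : Matrix (Fin d) (Fin d) 𝕜) : 0 ≤ frobSq A := by
  unfold frobSq
  positivity

lemma eq_zero_of_frobSq_eq_zero {A : Matrix (Fin d) (Fin d) 𝕜} (h : frobSq A = 0) : A = 0 := by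
  ext i j
  have h1 := (Finset.sum_eq_zero_iff_of_nonneg fun i _ =>
    Finset.sum_nonneg fun j _ => sq_nonneg ‖A i j‖).mp h i (Finset.mem_univ i)
  have h2 := (Finset.sum_eq_zero_iff_of_nonneg fun j _ => sq_nonneg ‖A i j‖).mp h1 j
    (Finset.mem_univ j)
  simpa using h2

@[simp] lemma frobSq_zero : frobSq (0 : Matrix (Fin d) (Fin d) 𝕜) = 0 := by
  simp [frobSq]

lemma HasEntryDerivWithinAt.frobSq {M : ℝ → Matrix (Fin d) (Fin d) 𝕜}
    {M' : Matrix (Fin d) (Fin d) 𝕜} {s : Set ℝ} {t : ℝ} (hM : HasEntryDerivWithinAt M M' s t) :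
    HasDerivWithinAt (fun τ => frobSq (M τ)) (2 * RCLike.re ((M t)ᴴ * M').trace) s t := by
  simp only [frobSq_eq_re_trace]
  convert (hM.conjTranspose.mul hM).re_trace using 1
  rw [Matrix.trace_add, map_add, ← re_trace_conjTranspose (M'ᴴ * M t)]
  simp only [Matrix.conjTranspose_mul, Matrix.conjTranspose_conjTranspose]
  ring

/-! ### Powers of positive semidefinite matrices -/

lemma eq_of_pow_eq_pow_of_posSemidef {A B : Matrix (Fin d) (Fin d) 𝕜} (hA : A.PosSemidef)
    (hB : B.PosSemidef) {n : ℕ} (hn : n ≠ 0) (h : A ^ n = B ^ n) : A = B := by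
  have root : ∀ C : Matrix (Fin d) (Fin d) 𝕜, C.PosSemidef →
      (C ^ n) ^ ((n : ℝ)⁻¹) = C := by
    intro C hC
    have hC' : 0 ≤ C := Matrix.nonneg_iff_posSemidef.mpr hC
    rw [← CFC.rpow_natCast C n hC', CFC.rpow_rpow_of_exponent_nonneg C _ _ (by positivity)
      (by positivity) hC', mul_inv_cancel₀ (by exact_mod_cast hn), CFC.rpow_one C hC']
  rw [← root A hA, h, root B hB]

lemma mul_pow_mul_conjTranspose (X : Matrix (Fin d) (Fin d) 𝕜) (n : ℕ) :
    X * (Xᴴ * X) ^ n * Xᴴ = (X * Xᴴ) ^ (n + 1) := by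
  induction n with
  | zero => simp
  | succ n ih => rw [pow_succ, pow_succ _ (n + 1), ← ih]; simp only [mul_assoc]

/-! ### Products of layers -/

/-- The product `W_{j+n} ⋯ W_{j+1}` of the `n` layers that follow layer `j`. -/
noncomputable def tailProd (W : ℕ → Matrix (Fin d) (Fin d) 𝕜) (j n : ℕ) :
    Matrix (Fin d) (Fin d) 𝕜 :=
  layerProd (fun i => W (j + i)) n

@[simp] lemma tailProd_zero (W : ℕ → Matrix (Fin d) (Fin d) 𝕜) (j : ℕ) : tailProd W j 0 = 1 := rfl

lemma layerProd_succ (W : ℕ → Matrix (Fin d) (Fin d) 𝕜) (n : ℕ) :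
    layerProd W (n + 1) = W (n + 1) * layerProd W n := rfl

lemma tailProd_succ (W : ℕ → Matrix (Fin d) (Fin d) 𝕜) (j n : ℕ) :
    tailProd W j (n + 1) = W (j + n + 1) * tailProd W j n := rfl

lemma layerProd_add (W : ℕ → Matrix (Fin d) (Fin d) 𝕜) (j n : ℕ) :
    layerProd W (j + n) = tailProd W j n * layerProd W j := by
  induction n with
  | zero => simp
  | succ n ih => rw [← add_assoc, layerProd_succ, tailProd_succ, ih, mul_assoc]

lemma layerProd_eq_tailProd_one_mul (W : ℕ → Matrix (Fin d) (Fin d) 𝕜) (n : ℕ) :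
    layerProd W (n + 1) = tailProd W 1 n * W 1 := by
  rw [add_comm, layerProd_add]
  simp [layerProd]

lemma tailProd_eq_tailProd_succ_mul (W : ℕ → Matrix (Fin d) (Fin d) 𝕜) (j n : ℕ) :
    tailProd W j (n + 1) = tailProd W (j + 1) n * W (j + 1) := by
  rw [tailProd, layerProd_eq_tailProd_one_mul]
  simp only [tailProd, add_assoc]

/-- Leibniz rule for a product of layers; `W' j` is the derivative of layer `j + 1`. -/
lemma hasEntryDerivWithinAt_layerProd {W : ℝ → ℕ → Matrix (Fin d) (Fin d) 𝕜}
    {W' : ℕ → Matrix (Fin d) (Fin d) 𝕜} {s : Set ℝ} {t : ℝ} {n : ℕ}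
    (hW : ∀ j ∈ Finset.range n, HasEntryDerivWithinAt (fun τ => W τ (j + 1)) (W' j) s t) :
    HasEntryDerivWithinAt (fun τ => layerProd (W τ) n)
      (∑ j ∈ Finset.range n, tailProd (W t) (j + 1) (n - 1 - j) * W' j * layerProd (W t) j)
      s t := by
  induction n with
  | zero => simpa [layerProd] using HasEntryDerivWithinAt.const _
  | succ n ih =>
    have h := (hW n (Finset.self_mem_range_succ n)).mul
      (ih fun j hj => hW j (Finset.mem_range.mpr ((Finset.mem_range.mp hj).trans n.lt_succ_self)))
    refine h.congr_deriv ?_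
    rw [Finset.sum_range_succ, add_comm, Finset.mul_sum]
    congr 1
    · refine Finset.sum_congr rfl fun j hj => ?_
      have hj' := Finset.mem_range.mp hj
      rw [show n + 1 - 1 - j = (n - 1 - j) + 1 by omega, tailProd_succ,
        show j + 1 + (n - 1 - j) + 1 = n + 1 by omega]
      simp only [mul_assoc]
    · simp

/-! ### The gradient of the loss -/

/-- The balance error at the interior positions `1 ≤ j < N`, extended by zero. -/
noncomputable def innerBalance (N : ℕ) (W : ℕ → Matrix (Fin d) (Fin d) 𝕜) (j : ℕ) :
    Matrix (Fin d) (Fin d) 𝕜 :=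
  if j ∈ Finset.Ico 1 N then balanceError W j else 0

/-- The gradient of `(1/4) ∑ ‖Δ_{j,j+1}‖_F ^ 2` with respect to layer `j + 1`. -/
noncomputable def balanceGradient (N : ℕ) (W : ℕ → Matrix (Fin d) (Fin d) 𝕜) (j : ℕ) :
    Matrix (Fin d) (Fin d) 𝕜 :=
  innerBalance N W (j + 1) * W (j + 1) - W (j + 1) * innerBalance N W j

/-- The negative gradient of `(1/2) ‖T - W_N ⋯ W_1‖_F ^ 2` with respect to layer `j + 1`. -/
noncomputable def descentDirection (N : ℕ) (T : Matrix (Fin d) (Fin d) 𝕜)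
    (W : ℕ → Matrix (Fin d) (Fin d) 𝕜) (j : ℕ) : Matrix (Fin d) (Fin d) 𝕜 :=
  (tailProd W (j + 1) (N - 1 - j))ᴴ * (T - layerProd W N) * (layerProd W j)ᴴ

lemma innerBalance_zero (N : ℕ) (W : ℕ → Matrix (Fin d) (Fin d) 𝕜) : innerBalance N W 0 = 0 := by
  simp [innerBalance]

lemma innerBalance_self (N : ℕ) (W : ℕ → Matrix (Fin d) (Fin d) 𝕜) : innerBalance N W N = 0 := by
  simp [innerBalance]

lemma conjTranspose_balanceError (W : ℕ → Matrix (Fin d) (Fin d) 𝕜) (j : ℕ) :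
    (balanceError W j)ᴴ = balanceError W j := by
  simp [balanceError]

lemma re_trace_mul_deriv_mul_conjTranspose {D : Matrix (Fin d) (Fin d) 𝕜} (hD : Dᴴ = D)
    (X X' : Matrix (Fin d) (Fin d) 𝕜) :
    RCLike.re (D * (X' * Xᴴ + X * X'ᴴ)).trace = 2 * RCLike.re ((D * X)ᴴ * X').trace := by
  have h1 : (D * (X' * Xᴴ)).trace = ((D * X)ᴴ * X').trace := by
    rw [Matrix.conjTranspose_mul, hD, ← mul_assoc, Matrix.trace_mul_comm, mul_assoc]
  have h2 : RCLike.re (D * (X * X'ᴴ)).trace = RCLike.re ((D * X)ᴴ * X').trace := by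
    rw [← h1, ← re_trace_conjTranspose (D * (X * X'ᴴ)), ← Matrix.trace_mul_comm (X' * Xᴴ) D]
    simp [hD]
  rw [mul_add, Matrix.trace_add, map_add, h1, h2]
  ring

lemma re_trace_mul_deriv_conjTranspose_mul {D : Matrix (Fin d) (Fin d) 𝕜} (hD : Dᴴ = D)
    (Y Y' : Matrix (Fin d) (Fin d) 𝕜) :
    RCLike.re (D * (Y'ᴴ * Y + Yᴴ * Y')).trace = 2 * RCLike.re ((Y * D)ᴴ * Y').trace := by
  have h1 : (D * (Yᴴ * Y')).trace = ((Y * D)ᴴ * Y').trace := by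
    rw [Matrix.conjTranspose_mul, hD, mul_assoc]
  have h2 : RCLike.re (D * (Y'ᴴ * Y)).trace = RCLike.re ((Y * D)ᴴ * Y').trace := by
    rw [← h1, ← re_trace_conjTranspose (D * (Y'ᴴ * Y)), ← Matrix.trace_mul_comm (Yᴴ * Y') D]
    simp [hD]
  rw [mul_add, Matrix.trace_add, map_add, h1, h2]
  ring

lemma hasDerivWithinAt_sum_frobSq_balanceError {N : ℕ} (hN : 0 < N)
    {W : ℝ → ℕ → Matrix (Fin d) (Fin d) 𝕜} {W' : ℕ → Matrix (Fin d) (Fin d) 𝕜}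
    {s : Set ℝ} {t : ℝ}
    (hW : ∀ j ∈ Finset.range N, HasEntryDerivWithinAt (fun τ => W τ (j + 1)) (W' j) s t) :
    HasDerivWithinAt (fun τ => ∑ j ∈ Finset.Ico 1 N, frobSq (balanceError (W τ) j))
      (4 * ∑ j ∈ Finset.range N, RCLike.re ((balanceGradient N (W t) j)ᴴ * W' j).trace) s t := by
  obtain ⟨m, rfl⟩ : ∃ m, N = m + 1 := ⟨N - 1, by omega⟩
  have hΔ : ∀ j ∈ Finset.range m, HasDerivWithinAt (fun τ => frobSq (balanceError (W τ) (j + 1)))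
      (4 * (RCLike.re ((innerBalance (m + 1) (W t) (j + 1) * W t (j + 1))ᴴ * W' j).trace -
        RCLike.re ((W t (j + 1 + 1) * innerBalance (m + 1) (W t) (j + 1))ᴴ * W' (j + 1)).trace))
      s t := by
    intro j hj
    have hj' := Finset.mem_range.mp hj
    have h1 := hW j (Finset.mem_range.mpr (by omega))
    have h2 := hW (j + 1) (Finset.mem_range.mpr (by omega))
    refine ((h1.mul h1.conjTranspose).sub (h2.conjTranspose.mul h2)).frobSq.congr_deriv ?_
    have hb : innerBalance (m + 1) (W t) (j + 1) = balanceError (W t) (j + 1) :=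
      if_pos (Finset.mem_Ico.mpr ⟨by omega, by omega⟩)
    have hH := conjTranspose_balanceError (W t) (j + 1)
    change 2 * RCLike.re ((balanceError (W t) (j + 1))ᴴ * _).trace = _
    rw [hb, hH, mul_sub, Matrix.trace_sub, map_sub, re_trace_mul_deriv_mul_conjTranspose hH,
      re_trace_mul_deriv_conjTranspose_mul hH]
    ring
  have hsum : ∀ τ, ∑ j ∈ Finset.Ico 1 (m + 1), frobSq (balanceError (W τ) j) =
      ∑ j ∈ Finset.range m, frobSq (balanceError (W τ) (j + 1)) := fun τ => by
    rw [Finset.sum_Ico_eq_sum_range]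
    simp [add_comm]
  simp only [hsum]
  refine (HasDerivWithinAt.fun_sum hΔ).congr_deriv ?_
  rw [← Finset.mul_sum, Finset.sum_sub_distrib]
  simp only [balanceGradient, Matrix.conjTranspose_sub, sub_mul, Matrix.trace_sub, map_sub,
    Finset.sum_sub_distrib]
  rw [Finset.sum_range_succ, Finset.sum_range_succ' (fun j => RCLike.re
    ((W t (j + 1) * innerBalance (m + 1) (W t) j)ᴴ * W' j).trace)]
  simp [innerBalance_zero, innerBalance_self]

lemma hasDerivWithinAt_loss {N : ℕ} (hN : 0 < N) (T : Matrix (Fin d) (Fin d) 𝕜) (a : ℝ)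
    {W : ℝ → ℕ → Matrix (Fin d) (Fin d) 𝕜} {W' : ℕ → Matrix (Fin d) (Fin d) 𝕜}
    {s : Set ℝ} {t : ℝ}
    (hW : ∀ j ∈ Finset.range N, HasEntryDerivWithinAt (fun τ => W τ (j + 1)) (W' j) s t) :
    HasDerivWithinAt (fun τ => loss N T a (W τ))
      (∑ j ∈ Finset.range N, RCLike.re
        ((a • balanceGradient N (W t) j - descentDirection N T (W t) j)ᴴ * W' j).trace) s t := by
  have h1 := (((HasEntryDerivWithinAt.const T).sub
    (hasEntryDerivWithinAt_layerProd hW)).frobSq).const_mul (1 / 2 : ℝ)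
  have h2 := (hasDerivWithinAt_sum_frobSq_balanceError hN hW).const_mul (a / 4)
  refine (h1.add h2).congr_deriv ?_
  have h3 : RCLike.re ((T - layerProd (W t) N)ᴴ * (0 - ∑ j ∈ Finset.range N,
        tailProd (W t) (j + 1) (N - 1 - j) * W' j * layerProd (W t) j)).trace =
      -∑ j ∈ Finset.range N, RCLike.re ((descentDirection N T (W t) j)ᴴ * W' j).trace := by
    rw [zero_sub, mul_neg, Matrix.trace_neg, map_neg, Finset.mul_sum, Matrix.trace_sum, map_sum]
    congr 1
    refine Finset.sum_congr rfl fun j _ => ?_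
    rw [← mul_assoc, ← mul_assoc, Matrix.trace_mul_comm]
    simp only [descentDirection, Matrix.conjTranspose_mul, Matrix.conjTranspose_conjTranspose,
      mul_assoc]
  rw [h3]
  simp only [Matrix.conjTranspose_sub, sub_mul, Matrix.trace_sub, map_sub, Finset.sum_sub_distrib,
    Matrix.conjTranspose_smul, star_trivial, Matrix.smul_mul, Matrix.trace_smul, RCLike.smul_re,
    ← Finset.mul_sum]
  ring

lemma IsMatrixGradient.eq_of_loss {N : ℕ} {T : Matrix (Fin d) (Fin d) 𝕜} {a : ℝ}
    {W : ℕ → Matrix (Fin d) (Fin d) 𝕜} {j : ℕ} (hj : j ∈ Finset.range N)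
    {G : Matrix (Fin d) (Fin d) 𝕜}
    (hG : IsMatrixGradient (fun X => loss N T a (Function.update W (j + 1) X)) (W (j + 1)) G) :
    G = a • balanceGradient N W j - descentDirection N T W j := by
  set G' := a • balanceGradient N W j - descentDirection N T W j with hG'
  have hN : 0 < N := (Nat.zero_le j).trans_lt (Finset.mem_range.mp hj)
  have key : ∀ H, RCLike.re (Gᴴ * H).trace = RCLike.re (G'ᴴ * H).trace := by
    intro H
    have hcurve : ∀ i ∈ Finset.range N, HasEntryDerivWithinAt
        (fun τ : ℝ => Function.update W (j + 1) (W (j + 1) + τ • H) (i + 1))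
        (if i = j then H else 0) univ 0 := by
      intro i _
      by_cases hij : i = j
      · subst hij
        intro p q
        have h := ((hasDerivAt_id (0 : ℝ)).smul_const (H p q)).const_add (W (i + 1) p q)
        simpa using h.hasDerivWithinAt (s := univ)
      · have hne : i + 1 ≠ j + 1 := by omega
        simpa [hij, hne] using HasEntryDerivWithinAt.const (s := univ) (t := 0) (W (i + 1))
    have h := hasDerivWithinAt_loss hN T a hcurve
    rw [hasDerivWithinAt_univ] at h
    rw [(hG H).unique h, Finset.sum_eq_single j]
    · simp [hG']
    · intro i _ hij
      simp [hij]
    · exact fun h => absurd hj h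
  have h0 : frobSq (G - G') = 0 := by
    rw [frobSq_eq_re_trace, Matrix.conjTranspose_sub, sub_mul, Matrix.trace_sub, map_sub, key,
      sub_self]
  exact sub_eq_zero.mp (eq_zero_of_frobSq_eq_zero h0)

lemma IsGradientFlow.hasEntryDerivWithinAt {N : ℕ} {T : Matrix (Fin d) (Fin d) 𝕜} {a : ℝ}
    {W : ℝ → ℕ → Matrix (Fin d) (Fin d) 𝕜} (h : IsGradientFlow N T a W) {t : ℝ}
    (ht : t ∈ Ici (0 : ℝ)) {j : ℕ} (hj : j ∈ Finset.range N) :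
    HasEntryDerivWithinAt (fun τ => W τ (j + 1))
      (descentDirection N T (W t) j - a • balanceGradient N (W t) j) (Ici 0) t := by
  have hj' := Finset.mem_range.mp hj
  obtain ⟨G, hG, hW⟩ := h t ht (j + 1) (Finset.mem_Icc.mpr ⟨by omega, by omega⟩)
  rw [← neg_sub, ← hG.eq_of_loss hj]
  exact hW

/-! ### Conservation of balancedness -/

/-- The two parts of the gradient are orthogonal: the square loss is invariant under the
reparametrizations `W_j ↦ g_j W_j g_{j-1}⁻¹` with `g_0 = g_N = 1`, and the gradient of the balance
regularizer is tangent to their orbit. Concretely the inner products telescope. -/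
lemma sum_re_trace_balanceGradient_mul_descentDirection (N : ℕ) (T : Matrix (Fin d) (Fin d) 𝕜)
    (W : ℕ → Matrix (Fin d) (Fin d) 𝕜) :
    ∑ j ∈ Finset.range N,
      RCLike.re ((balanceGradient N W j)ᴴ * descentDirection N T W j).trace = 0 := by
  set z : ℕ → ℝ := fun j => RCLike.re
    (layerProd W j * (T - layerProd W N)ᴴ * tailProd W j (N - j) * innerBalance N W j).trace with hz
  have hterm : ∀ j ∈ Finset.range N,
      RCLike.re ((balanceGradient N W j)ᴴ * descentDirection N T W j).trace = z (j + 1) - z j := by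
    intro j hj
    have hj' := Finset.mem_range.mp hj
    rw [← re_trace_conjTranspose, Matrix.conjTranspose_mul, Matrix.conjTranspose_conjTranspose,
      balanceGradient, mul_sub, Matrix.trace_sub, map_sub]
    simp only [hz]
    congr 2
    · rw [← mul_assoc, Matrix.trace_mul_comm, layerProd_succ,
        show N - (j + 1) = N - 1 - j by omega]
      simp only [descentDirection, Matrix.conjTranspose_mul, Matrix.conjTranspose_conjTranspose,
        mul_assoc]
    · rw [show N - j = (N - 1 - j) + 1 by omega, tailProd_eq_tailProd_succ_mul]
      simp only [descentDirection, Matrix.conjTranspose_mul, Matrix.conjTranspose_conjTranspose,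
        mul_assoc]
  rw [Finset.sum_congr rfl hterm, Finset.sum_range_sub]
  simp [hz, innerBalance_zero, innerBalance_self]

/-- A balanced initialization stays balanced, because the balance regularizer does not increase
along the flow. -/
lemma IsGradientFlow.isBalanced {N : ℕ} (hN : 0 < N) {T : Matrix (Fin d) (Fin d) 𝕜} {a : ℝ}
    (ha : 0 ≤ a) {W : ℝ → ℕ → Matrix (Fin d) (Fin d) 𝕜} (h : IsGradientFlow N T a W)
    (h0 : IsBalanced N (W 0)) {t : ℝ} (ht : t ∈ Ici (0 : ℝ)) : IsBalanced N (W t) := by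
  set R : ℝ → ℝ := fun τ => ∑ j ∈ Finset.Ico 1 N, frobSq (balanceError (W τ) j) with hR
  have hderiv : ∀ τ ∈ Ici (0 : ℝ), HasDerivWithinAt R
      (-(4 * a * ∑ j ∈ Finset.range N, frobSq (balanceGradient N (W τ) j))) (Ici 0) τ := by
    intro τ hτ
    refine (hasDerivWithinAt_sum_frobSq_balanceError hN
      (fun j hj => h.hasEntryDerivWithinAt hτ hj)).congr_deriv ?_
    simp only [mul_sub, Matrix.trace_sub, map_sub, Finset.sum_sub_distrib,
      sum_re_trace_balanceGradient_mul_descentDirection, Matrix.mul_smul, Matrix.trace_smul,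
      RCLike.smul_re, ← Finset.mul_sum, frobSq_eq_re_trace]
    ring
  have hanti : AntitoneOn R (Ici 0) := by
    refine antitoneOn_of_hasDerivWithinAt_nonpos (convex_Ici 0)
      (fun τ hτ => (hderiv τ hτ).continuousWithinAt)
      (fun τ hτ => (hderiv τ (interior_subset hτ)).mono interior_subset) fun τ _ => ?_
    have : 0 ≤ ∑ j ∈ Finset.range N, frobSq (balanceGradient N (W τ) j) :=
      Finset.sum_nonneg fun j _ => frobSq_nonneg _
    rw [neg_nonpos]
    positivity
  have hRt : R t = 0 := by
    refine le_antisymm ?_ (Finset.sum_nonneg fun j _ => frobSq_nonneg _)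
    refine (hanti self_mem_Ici ht ht).trans_eq ?_
    exact Finset.sum_eq_zero fun j hj => by rw [h0 j hj, frobSq_zero]
  intro j hj
  exact eq_zero_of_frobSq_eq_zero
    ((Finset.sum_eq_zero_iff_of_nonneg fun j _ => frobSq_nonneg _).mp hRt j hj)

lemma IsBalanced.mul_conjTranspose {N : ℕ} {W : ℕ → Matrix (Fin d) (Fin d) 𝕜}
    (h : IsBalanced N W) {j : ℕ} (h1 : 1 ≤ j) (h2 : j < N) :
    W j * (W j)ᴴ = (W (j + 1))ᴴ * W (j + 1) :=
  sub_eq_zero.mp (h j (Finset.mem_Ico.mpr ⟨h1, h2⟩))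

lemma IsBalanced.mono {N n : ℕ} {W : ℕ → Matrix (Fin d) (Fin d) 𝕜} (h : IsBalanced N W)
    (hn : n ≤ N) : IsBalanced n W := fun j hj =>
  h j (Finset.Ico_subset_Ico_right hn hj)

lemma IsBalanced.shift {j n : ℕ} {W : ℕ → Matrix (Fin d) (Fin d) 𝕜}
    (h : IsBalanced (j + n) W) : IsBalanced n fun i => W (j + i) := fun i hi => by
  have hi' := Finset.mem_Ico.mp hi
  exact h (j + i) (Finset.mem_Ico.mpr ⟨by omega, by omega⟩)

lemma IsBalanced.layerProd_mul_conjTranspose {n : ℕ} {W : ℕ → Matrix (Fin d) (Fin d) 𝕜}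
    (h : IsBalanced n W) : layerProd W n * (layerProd W n)ᴴ = (W n * (W n)ᴴ) ^ n := by
  induction n with
  | zero => simp [layerProd]
  | succ n ih =>
    have e : layerProd W (n + 1) * (layerProd W (n + 1))ᴴ =
        W (n + 1) * (layerProd W n * (layerProd W n)ᴴ) * (W (n + 1))ᴴ := by
      simp only [layerProd_succ, Matrix.conjTranspose_mul, mul_assoc]
    rw [e, ih (h.mono n.le_succ), ← mul_pow_mul_conjTranspose]
    rcases n.eq_zero_or_pos with rfl | hn
    · simp
    · rw [h.mul_conjTranspose hn n.lt_succ_self]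

lemma IsBalanced.tailProd_mul_conjTranspose {j n : ℕ} {W : ℕ → Matrix (Fin d) (Fin d) 𝕜}
    (h : IsBalanced (j + n) W) :
    tailProd W j n * (tailProd W j n)ᴴ = (W (j + n) * (W (j + n))ᴴ) ^ n :=
  h.shift.layerProd_mul_conjTranspose

lemma IsBalanced.conjTranspose_mul_layerProd {n : ℕ} {W : ℕ → Matrix (Fin d) (Fin d) 𝕜}
    (h : IsBalanced n W) : (layerProd W n)ᴴ * layerProd W n = ((W 1)ᴴ * W 1) ^ n := by
  induction n generalizing W with
  | zero => simp [layerProd]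
  | succ n ih =>
    have e : (layerProd W (n + 1))ᴴ * layerProd W (n + 1) =
        (W 1)ᴴ * ((tailProd W 1 n)ᴴ * tailProd W 1 n) * ((W 1)ᴴ)ᴴ := by
      simp only [layerProd_eq_tailProd_one_mul, Matrix.conjTranspose_mul, mul_assoc,
        Matrix.conjTranspose_conjTranspose]
    have hs : (tailProd W 1 n)ᴴ * tailProd W 1 n = ((W (1 + 1))ᴴ * W (1 + 1)) ^ n :=
      ih (W := fun i => W (1 + i)) (IsBalanced.shift (by rwa [add_comm]))
    have hp := mul_pow_mul_conjTranspose (W 1)ᴴ n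
    rw [Matrix.conjTranspose_conjTranspose] at hp
    rw [e, hs, ← hp, Matrix.conjTranspose_conjTranspose]
    rcases n.eq_zero_or_pos with rfl | hn
    · simp
    · rw [h.mul_conjTranspose le_rfl (by omega)]

/-- Along a balanced flow the end-to-end matrix `W = W_N ⋯ W_1` obeys a closed equation up to the
two outer Gram matrices, which are the `N`-th roots of `W Wᴴ` and `Wᴴ W`. -/
lemma IsGradientFlow.hasEntryDerivWithinAt_layerProd {N : ℕ} (hN : 0 < N)
    {T : Matrix (Fin d) (Fin d) 𝕜} {a : ℝ} (ha : 0 ≤ a) {W : ℝ → ℕ → Matrix (Fin d) (Fin d) 𝕜}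
    (h : IsGradientFlow N T a W) (h0 : IsBalanced N (W 0)) {t : ℝ} (ht : t ∈ Ici (0 : ℝ)) :
    HasEntryDerivWithinAt (fun τ => layerProd (W τ) N)
      (∑ j ∈ Finset.range N, (W t N * (W t N)ᴴ) ^ (N - 1 - j) * (T - layerProd (W t) N) *
        ((W t 1)ᴴ * W t 1) ^ j) (Ici 0) t := by
  have hb := h.isBalanced hN ha h0 ht
  have hzero : ∀ j, balanceGradient N (W t) j = 0 := by
    have hi : ∀ j, innerBalance N (W t) j = 0 := fun j => by
      unfold innerBalance
      split_ifs with hj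
      · exact hb j hj
      · rfl
    intro j
    simp [balanceGradient, hi]
  refine (DeepMF.hasEntryDerivWithinAt_layerProd
    (fun j hj => h.hasEntryDerivWithinAt ht hj)).congr_deriv ?_
  refine Finset.sum_congr rfl fun j hj => ?_
  have hj' := Finset.mem_range.mp hj
  have e : j + 1 + (N - 1 - j) = N := by omega
  have h1 := IsBalanced.tailProd_mul_conjTranspose (j := j + 1) (n := N - 1 - j) (W := W t)
    (by rwa [e])
  rw [e] at h1
  rw [← h1, ← (hb.mono hj'.le).conjTranspose_mul_layerProd, hzero, smul_zero, sub_zero,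
    descentDirection]
  simp only [mul_assoc]

/-! ### Real diagonal matrices and traces -/

@[simp] lemma conjTranspose_diagReal (σ : Fin d → ℝ) :
    (diagReal 𝕜 σ)ᴴ = diagReal 𝕜 σ := by
  ext i j
  by_cases h : i = j
  · subst h; simp [diagReal]
  · simp [diagReal, h, Ne.symm h]

lemma diagReal_pow (σ : Fin d → ℝ) (n : ℕ) :
    diagReal 𝕜 σ ^ n = diagReal 𝕜 fun j => σ j ^ n := by
  simp only [diagReal, Matrix.diagonal_pow]
  congr 1
  ext j
  simp

lemma mul_diagReal_apply (A : Matrix (Fin d) (Fin d) 𝕜) (σ : Fin d → ℝ) (j k : Fin d) :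
    (A * diagReal 𝕜 σ) j k = A j k * (σ k : 𝕜) := by
  simp [diagReal]

lemma diagReal_mul_apply (A : Matrix (Fin d) (Fin d) 𝕜) (σ : Fin d → ℝ) (j k : Fin d) :
    (diagReal 𝕜 σ * A) j k = (σ j : 𝕜) * A j k := by
  simp [diagReal]

lemma re_trace_mul_comm (A B : Matrix (Fin d) (Fin d) 𝕜) :
    RCLike.re (A * B).trace = RCLike.re (B * A).trace := by
  rw [Matrix.trace_mul_comm]

/-- A conjugate-transposed factor may be replaced by the factor itself when the other factor is
Hermitian. -/
lemma re_trace_conjTranspose_mul_of_conjTranspose_eq {Z : Matrix (Fin d) (Fin d) 𝕜} (hZ : Zᴴ = Z)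
    (P : Matrix (Fin d) (Fin d) 𝕜) :
    RCLike.re (Pᴴ * Z).trace = RCLike.re (P * Z).trace := by
  rw [← re_trace_conjTranspose, Matrix.conjTranspose_mul, hZ, Matrix.conjTranspose_conjTranspose,
    re_trace_mul_comm]

lemma re_trace_conjTranspose_mul_of_conjTranspose_eq_neg {Z : Matrix (Fin d) (Fin d) 𝕜}
    (hZ : Zᴴ = -Z) (P : Matrix (Fin d) (Fin d) 𝕜) :
    RCLike.re (Pᴴ * Z).trace = -RCLike.re (P * Z).trace := by
  rw [← re_trace_conjTranspose, Matrix.conjTranspose_mul, hZ, Matrix.conjTranspose_conjTranspose,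
    neg_mul, Matrix.trace_neg, map_neg, re_trace_mul_comm]

lemma sum_mul_norm_col_sq (Y : Matrix (Fin d) (Fin d) 𝕜) (w : Fin d → ℝ) :
    ∑ j, w j * ‖WithLp.toLp 2 (Y.col j)‖ ^ 2 = RCLike.re (Yᴴ * Y * diagReal 𝕜 w).trace := by
  simp only [Matrix.trace, Matrix.diag_apply, mul_diagReal_apply, map_sum]
  refine Finset.sum_congr rfl fun j _ => ?_
  rw [EuclideanSpace.norm_sq_eq, RCLike.re_mul_ofReal, mul_comm, Matrix.mul_apply, map_sum]
  congr 1
  refine Finset.sum_congr rfl fun i _ => ?_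
  rw [Matrix.conjTranspose_apply, RCLike.star_def, RCLike.conj_mul, ← RCLike.ofReal_pow,
    RCLike.ofReal_re]
  rfl

/-! ### The singular frame -/

/-- The factor `∑_l x^(2l) y^(2(N-1-l))` by which the flow of `W` weights the entry of the residual
that couples the singular values `x ^ N` and `y ^ N`. -/
noncomputable def couplingWeight (N : ℕ) (x y : ℝ) : ℝ :=
  ∑ l ∈ Finset.range N, (x ^ 2) ^ l * (y ^ 2) ^ (N - 1 - l)

lemma couplingWeight_comm (N : ℕ) (x y : ℝ) : couplingWeight N x y = couplingWeight N y x :=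
  Commute.geom_sum₂_comm N (Commute.all _ _)

lemma couplingWeight_mul_sub (N : ℕ) (x y : ℝ) :
    couplingWeight N x y * (x ^ 2 - y ^ 2) = (x ^ N) ^ 2 - (y ^ N) ^ 2 := by
  rw [couplingWeight, geom_sum₂_mul, ← pow_mul, ← pow_mul, ← pow_mul, ← pow_mul, mul_comm]

lemma couplingWeight_self (N : ℕ) (x : ℝ) :
    couplingWeight N x x = N * (x ^ 2) ^ (N - 1) := by
  rw [couplingWeight, geom_sum₂_self]

lemma couplingWeight_pos {N : ℕ} (hN : 0 < N) {x y : ℝ} (hx : 0 < x) (hy : 0 < y) :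
    0 < couplingWeight N x y :=
  Finset.sum_pos (fun l _ => by positivity) ⟨0, Finset.mem_range.mpr hN⟩

/-- The relation that brings `fN` into the derivative of the skew-Hermitian error. -/
lemma add_sq_mul_couplingWeight {N : ℕ} (hN : 2 ≤ N) {x y : ℝ} (hx : 0 < x) (hy : 0 < y) :
    (x ^ 2 + y ^ 2) * couplingWeight N x y =
      (2 * fN N x y + x ^ N + y ^ N) * (x ^ N + y ^ N) := by
  obtain ⟨n, rfl⟩ : ∃ n, N = n + 2 := ⟨N - 2, by omega⟩
  by_cases h : y = x
  · subst h
    rw [couplingWeight_self, fN, if_pos rfl, show n + 2 - 1 = n + 1 by omega]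
    push_cast
    ring
  · have hxy : x ^ 2 - y ^ 2 ≠ 0 := by
      rw [sub_ne_zero, Ne, sq_eq_sq₀ hx.le hy.le]
      exact Ne.symm h
    have hc := couplingWeight_mul_sub (n + 2) x y
    have hf : fN (n + 2) x y * (x ^ 2 - y ^ 2) = x ^ 2 * y ^ 2 * (x ^ n - y ^ n) := by
      rw [fN, if_neg h, div_mul_cancel₀ _ hxy, Nat.add_sub_cancel]
    apply mul_right_cancel₀ hxy
    rw [pow_add, pow_add] at *
    linear_combination (x ^ 2 + y ^ 2) * hc - 2 * (x ^ n * x ^ 2 + y ^ n * y ^ 2) * hf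

/-- The flow of a matrix `U S Vᴴ`, read in its own singular frame at one instant. `A = Uᴴ U'` and
`B = Vᴴ V'` are the velocities of the frames, `s = σ ^ N` are the singular values and `ds` their
velocities, and `P = Uᴴ T V` is the target. -/
structure IsFrameFlow (N : ℕ) (A B P : Matrix (Fin d) (Fin d) 𝕜) (σ ds : Fin d → ℝ) : Prop where
  skew_left : Aᴴ = -A
  skew_right : Bᴴ = -B
  flow : A * diagReal 𝕜 σ ^ N - diagReal 𝕜 σ ^ N * B + diagReal 𝕜 ds =
    ∑ l ∈ Finset.range N, (diagReal 𝕜 σ ^ 2) ^ (N - 1 - l) * (P - diagReal 𝕜 σ ^ N) *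
      (diagReal 𝕜 σ ^ 2) ^ l

namespace IsFrameFlow

variable {N : ℕ} {A B P : Matrix (Fin d) (Fin d) 𝕜} {σ ds : Fin d → ℝ}

lemma star_left_apply (h : IsFrameFlow N A B P σ ds) (j k : Fin d) : star (A k j) = -A j k := by
  rw [← Matrix.conjTranspose_apply, h.skew_left, Matrix.neg_apply]

lemma star_right_apply (h : IsFrameFlow N A B P σ ds) (j k : Fin d) : star (B k j) = -B j k := by
  rw [← Matrix.conjTranspose_apply, h.skew_right, Matrix.neg_apply]

lemma flow_apply (h : IsFrameFlow N A B P σ ds) (j k : Fin d) :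
    A j k * (σ k ^ N : ℝ) - (σ j ^ N : ℝ) * B j k + diagReal 𝕜 ds j k =
      couplingWeight N (σ j) (σ k) * (P j k - diagReal 𝕜 (fun i => σ i ^ N) j k) := by
  have e := congrFun (congrFun h.flow j) k
  simp only [diagReal_pow, Matrix.add_apply, Matrix.sub_apply, Matrix.sum_apply,
    mul_diagReal_apply, diagReal_mul_apply] at e
  rw [e, couplingWeight_comm, couplingWeight, RCLike.ofReal_sum, Finset.sum_mul]
  refine Finset.sum_congr rfl fun l _ => ?_
  push_cast
  ring

/-- The adjoint of `flow_apply`. -/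
lemma star_flow_apply (h : IsFrameFlow N A B P σ ds) (j k : Fin d) :
    -A j k * (σ j ^ N : ℝ) + (σ k ^ N : ℝ) * B j k + diagReal 𝕜 ds j k =
      couplingWeight N (σ j) (σ k) * (star (P k j) - diagReal 𝕜 (fun i => σ i ^ N) j k) := by
  have e := congrArg star (h.flow_apply k j)
  have hd : ∀ τ : Fin d → ℝ, star (diagReal 𝕜 τ k j) = diagReal 𝕜 τ j k := fun τ => by
    rw [← Matrix.conjTranspose_apply, conjTranspose_diagReal]
  have hr : ∀ r : ℝ, star (r : 𝕜) = r := fun r => RCLike.conj_ofReal r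
  simp only [star_add, star_sub, star_mul', hd, hr, h.star_left_apply, h.star_right_apply] at e
  rw [couplingWeight_comm, ← e]
  ring

lemma velocity_eq (h : IsFrameFlow N A B P σ ds) (j : Fin d) :
    ds j = N * (σ j ^ 2) ^ (N - 1) * (RCLike.re (P j j) - σ j ^ N) := by
  -- The sum of the diagonal equation and its adjoint is free of `A` and `B`.
  have e1 := congrArg RCLike.re (h.flow_apply j j)
  have e2 := congrArg RCLike.re (h.star_flow_apply j j)
  simp only [diagReal, Matrix.diagonal_apply_eq, RCLike.re_ofReal_mul, RCLike.re_mul_ofReal,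
    map_add, map_sub, map_neg, RCLike.ofReal_re, RCLike.star_def, RCLike.conj_re,
    couplingWeight_self] at e1 e2
  linarith

/-- Elimination of `B`. Where two singular values coincide, this is a condition on `P`, not on `A`;
it still holds, and no division by `σ_k² - σ_j²` is needed. -/
lemma left_commutator (hN : 0 < N) (hσ : ∀ j, 0 < σ j) (h : IsFrameFlow N A B P σ ds) :
    A * diagReal 𝕜 σ ^ 2 - diagReal 𝕜 σ ^ 2 * A +
      diagReal 𝕜 (fun j => 2 * σ j ^ N * RCLike.re (P j j)) =
      P * diagReal 𝕜 σ ^ N + diagReal 𝕜 σ ^ N * Pᴴ := by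
  ext j k
  simp only [diagReal_pow, Matrix.add_apply, Matrix.sub_apply, mul_diagReal_apply,
    diagReal_mul_apply, Matrix.conjTranspose_apply]
  by_cases hjk : j = k
  · subst hjk
    have hre := RCLike.add_conj (P j j)
    simp only [diagReal, Matrix.diagonal_apply_eq, RCLike.star_def]
    push_cast
    linear_combination -(σ j : 𝕜) ^ N * hre
  · have e1 := h.flow_apply j k
    have e2 := h.star_flow_apply j k
    have hc : ((couplingWeight N (σ j) (σ k) : ℝ) : 𝕜) ≠ 0 :=
      RCLike.ofReal_ne_zero.mpr (couplingWeight_pos hN (hσ j) (hσ k)).ne'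
    have hcs := congrArg (RCLike.ofReal (K := 𝕜)) (couplingWeight_mul_sub N (σ j) (σ k))
    push_cast at hcs
    simp only [diagReal, Matrix.diagonal_apply_ne _ hjk, add_zero, sub_zero] at e1 e2 ⊢
    push_cast at e1 e2 ⊢
    apply mul_left_cancel₀ hc
    linear_combination (σ k : 𝕜) ^ N * e1 + (σ j : 𝕜) ^ N * e2 - A j k * hcs

lemma right_commutator (hN : 0 < N) (hσ : ∀ j, 0 < σ j) (h : IsFrameFlow N A B P σ ds) :
    B * diagReal 𝕜 σ ^ 2 - diagReal 𝕜 σ ^ 2 * B +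
      diagReal 𝕜 (fun j => 2 * σ j ^ N * RCLike.re (P j j)) =
      diagReal 𝕜 σ ^ N * P + Pᴴ * diagReal 𝕜 σ ^ N := by
  ext j k
  simp only [diagReal_pow, Matrix.add_apply, Matrix.sub_apply, mul_diagReal_apply,
    diagReal_mul_apply, Matrix.conjTranspose_apply]
  by_cases hjk : j = k
  · subst hjk
    have hre := RCLike.add_conj (P j j)
    simp only [diagReal, Matrix.diagonal_apply_eq, RCLike.star_def]
    push_cast
    linear_combination -(σ j : 𝕜) ^ N * hre
  · have e1 := h.flow_apply j k
    have e2 := h.star_flow_apply j k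
    have hc : ((couplingWeight N (σ j) (σ k) : ℝ) : 𝕜) ≠ 0 :=
      RCLike.ofReal_ne_zero.mpr (couplingWeight_pos hN (hσ j) (hσ k)).ne'
    have hcs := congrArg (RCLike.ofReal (K := 𝕜)) (couplingWeight_mul_sub N (σ j) (σ k))
    push_cast at hcs
    simp only [diagReal, Matrix.diagonal_apply_ne _ hjk, add_zero, sub_zero] at e1 e2 ⊢
    push_cast at e1 e2 ⊢
    apply mul_left_cancel₀ hc
    linear_combination (σ j : 𝕜) ^ N * e1 + (σ k : 𝕜) ^ N * e2 - B j k * hcs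

/-- The relative velocity `A - B` of the two frames is driven by `P - Pᴴ`; this is where the
weights `fN` come from. -/
lemma anticommutator (hN : 2 ≤ N) (hσ : ∀ j, 0 < σ j) (h : IsFrameFlow N A B P σ ds) :
    (A - B) * diagReal 𝕜 σ ^ 2 + diagReal 𝕜 σ ^ 2 * (A - B) =
      Matrix.of (fun j k => ((2 * fN N (σ j) (σ k) : ℝ) : 𝕜) * (P - Pᴴ) j k) +
        ((P - Pᴴ) * diagReal 𝕜 σ ^ N + diagReal 𝕜 σ ^ N * (P - Pᴴ)) := by
  ext j k
  have e1 := h.flow_apply j k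
  have e2 := h.star_flow_apply j k
  have hw := congrArg (RCLike.ofReal (K := 𝕜)) (add_sq_mul_couplingWeight hN (hσ j) (hσ k))
  have hs : ((σ j ^ N + σ k ^ N : ℝ) : 𝕜) ≠ 0 :=
    RCLike.ofReal_ne_zero.mpr (add_pos (pow_pos (hσ j) N) (pow_pos (hσ k) N)).ne'
  simp only [diagReal_pow, Matrix.add_apply, Matrix.sub_apply, mul_diagReal_apply,
    diagReal_mul_apply, Matrix.conjTranspose_apply, Matrix.of_apply]
  push_cast at e1 e2 hw hs ⊢
  apply mul_right_cancel₀ hs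
  linear_combination ((σ j : 𝕜) ^ 2 + (σ k : 𝕜) ^ 2) * (e1 - e2) + (P j k - star (P k j)) * hw

end IsFrameFlow

/-! ### The derivative of the skew-Hermitian error in the singular frame -/

/-- The contribution of `Q = Uᴴ T U` to the derivative. Only the commutator of the frame velocity
with `Σ_w²` enters. -/
lemma re_trace_deriv_of_commutator {A D D' P Q S : Matrix (Fin d) (Fin d) 𝕜} (hQ : Qᴴ = Q)
    (hS : Sᴴ = S) (hA : A * D - D * A + D' = P * S + S * Pᴴ - (S * S + S * S)) :
    RCLike.re (D' * Q + D * (Q * A - A * Q)).trace =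
      2 * RCLike.re (Q * P * S).trace - 2 * RCLike.re (Q * (S * S)).trace := by
  have e : (D' * Q + D * (Q * A - A * Q)).trace = (Q * (A * D - D * A + D')).trace := by
    simp only [mul_add, mul_sub, Matrix.trace_add, Matrix.trace_sub]
    rw [Matrix.trace_mul_comm D' Q, Matrix.trace_mul_comm D (Q * A), ← mul_assoc D A Q,
      Matrix.trace_mul_comm (D * A) Q, mul_assoc Q A D]
    ring
  have h1 : RCLike.re (Q * (S * Pᴴ)).trace = RCLike.re (Q * (P * S)).trace := by
    rw [← re_trace_conjTranspose]
    simp only [Matrix.conjTranspose_mul, Matrix.conjTranspose_conjTranspose, hS, hQ]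
    exact re_trace_mul_comm _ _
  rw [e, hA, mul_sub, mul_add, mul_add, Matrix.trace_sub, Matrix.trace_add, Matrix.trace_add,
    map_sub, map_add, map_add, h1, mul_assoc]
  ring

/-- The contribution of the coupling `P = Uᴴ T V` to the derivative, in terms of the Hermitian part
`P + Pᴴ` and the skew-Hermitian part `P - Pᴴ`. -/
lemma re_trace_deriv_of_commutators {A B D D' P S F : Matrix (Fin d) (Fin d) 𝕜}
    (hAs : Aᴴ = -A) (hBs : Bᴴ = -B) (hS : Sᴴ = S) (hD : Dᴴ = D)
    (hA : A * D - D * A + D' = P * S + S * Pᴴ - (S * S + S * S))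
    (hB : B * D - D * B + D' = S * P + Pᴴ * S - (S * S + S * S))
    (hF : (A - B) * D + D * (A - B) = F + ((P - Pᴴ) * S + S * (P - Pᴴ))) :
    2 * RCLike.re (D' * P + D * (P * B - A * P)).trace =
      RCLike.re ((P + Pᴴ) * (P + Pᴴ) * S).trace - 4 * RCLike.re (P * (S * S)).trace
        - RCLike.re ((P - Pᴴ) * (P - Pᴴ) * S).trace - 1 / 2 * RCLike.re ((P - Pᴴ) * F).trace := by
  have e : (D' * P + D * (P * B - A * P)).trace = (P * (B * D - D * A + D')).trace := by
    simp only [mul_add, mul_sub, Matrix.trace_add, Matrix.trace_sub]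
    rw [Matrix.trace_mul_comm D' P, Matrix.trace_mul_comm D (P * B), ← mul_assoc D A P,
      Matrix.trace_mul_comm (D * A) P, mul_assoc P B D]
    ring
  set Z := (P + Pᴴ) * S + S * (P + Pᴴ) with hZ
  set K := (A - B) * D + D * (A - B) with hK
  have hsplit : (B * D - D * A + D') + (B * D - D * A + D') =
      Z - (S * S + S * S + (S * S + S * S)) - K := by
    have : (B * D - D * A + D') + (B * D - D * A + D') =
        (A * D - D * A + D') + (B * D - D * B + D') - K := by
      rw [hK]; noncomm_ring
    rw [this, hA, hB, hZ]
    noncomm_ring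
  have hZh : Zᴴ = Z := by
    simp only [hZ, Matrix.conjTranspose_add, Matrix.conjTranspose_mul,
      Matrix.conjTranspose_conjTranspose, hS]
    noncomm_ring
  have hKh : Kᴴ = -K := by
    simp only [hK, Matrix.conjTranspose_add, Matrix.conjTranspose_sub, Matrix.conjTranspose_mul,
      hAs, hBs, hD]
    noncomm_ring
  have hPZ : 2 * RCLike.re (P * Z).trace = 2 * RCLike.re ((P + Pᴴ) * (P + Pᴴ) * S).trace := by
    have h1 : RCLike.re ((P + Pᴴ) * Z).trace = 2 * RCLike.re (P * Z).trace := by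
      rw [add_mul, Matrix.trace_add, map_add,
        re_trace_conjTranspose_mul_of_conjTranspose_eq hZh]
      ring
    rw [← h1, hZ, mul_add, Matrix.trace_add, map_add, ← mul_assoc, ← mul_assoc,
      Matrix.trace_mul_comm ((P + Pᴴ) * S), ← mul_assoc]
    ring
  have hPK : 2 * RCLike.re (P * K).trace =
      RCLike.re ((P - Pᴴ) * F).trace + 2 * RCLike.re ((P - Pᴴ) * (P - Pᴴ) * S).trace := by
    have h1 : RCLike.re ((P - Pᴴ) * K).trace = 2 * RCLike.re (P * K).trace := by
      rw [sub_mul, Matrix.trace_sub, map_sub,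
        re_trace_conjTranspose_mul_of_conjTranspose_eq_neg hKh]
      ring
    rw [← h1, hF, mul_add, mul_add, Matrix.trace_add, Matrix.trace_add, map_add, map_add,
      ← mul_assoc, ← mul_assoc, Matrix.trace_mul_comm ((P - Pᴴ) * S), ← mul_assoc]
    ring
  have h2 : 2 * RCLike.re (P * (B * D - D * A + D')).trace =
      RCLike.re (P * Z).trace - 4 * RCLike.re (P * (S * S)).trace - RCLike.re (P * K).trace := by
    have := congrArg (fun X => RCLike.re (P * X).trace) hsplit
    simp only [mul_add, mul_sub, Matrix.trace_add, Matrix.trace_sub, map_add, map_sub] at this ⊢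
    linarith
  rw [e, h2]
  linarith

lemma re_trace_weighted_mul_of_skew {X : Matrix (Fin d) (Fin d) 𝕜} (hX : Xᴴ = -X)
    (w : Fin d → Fin d → ℝ) :
    RCLike.re (X * Matrix.of fun j k => ((w j k : ℝ) : 𝕜) * X j k).trace =
      -∑ j, ∑ k, w j k * ‖X j k‖ ^ 2 := by
  rw [re_trace_mul_comm]
  simp only [Matrix.trace, Matrix.diag_apply, Matrix.mul_apply, Matrix.of_apply, map_sum,
    ← Finset.sum_neg_distrib]
  refine Finset.sum_congr rfl fun j _ => Finset.sum_congr rfl fun k _ => ?_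
  have h : X k j = -star (X j k) := by
    rw [← Matrix.conjTranspose_apply, hX, Matrix.neg_apply, neg_neg]
  rw [h, mul_assoc, RCLike.re_ofReal_mul, mul_neg, map_neg, RCLike.star_def, RCLike.mul_conj,
    ← RCLike.ofReal_pow, RCLike.ofReal_re]
  ring

/-- The derivative formula in the singular frame, for `P = Uᴴ T V`, `Q = Uᴴ T U`, `R = Vᴴ T V`. -/
lemma IsFrameFlow.re_trace_deriv {N : ℕ} (hN : 2 ≤ N) {A B P Q R : Matrix (Fin d) (Fin d) 𝕜}
    {σ ds : Fin d → ℝ} (hσ : ∀ j, 0 < σ j) (h : IsFrameFlow N A B P σ ds)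
    (hQ : Qᴴ = Q) (hR : Rᴴ = R) (hQP : Q * P = P * R) :
    RCLike.re
      (diagReal 𝕜 (fun j => 2 * σ j ^ N * (RCLike.re (P j j) - σ j ^ N)) * (Q + R - (P + P)) +
        diagReal 𝕜 σ ^ 2 * ((Q * A - A * Q) + (R * B - B * R) -
          ((P * B - A * P) + (P * B - A * P)))).trace =
      -(2 * RCLike.re ((P * Pᴴ + Pᴴ * P - (Q * P + Q * P)) * diagReal 𝕜 σ ^ N).trace)
        - 2 * RCLike.re ((Q + R - (P + P)) * (diagReal 𝕜 σ ^ N * diagReal 𝕜 σ ^ N)).trace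
        - ∑ j, ∑ k, fN N (σ j) (σ k) * ‖(P - Pᴴ) j k‖ ^ 2 := by
  set D' := diagReal 𝕜 (fun j => 2 * σ j ^ N * (RCLike.re (P j j) - σ j ^ N)) with hD'
  set S := diagReal 𝕜 σ ^ N with hS
  set D := diagReal 𝕜 σ ^ 2 with hD
  have hSh : Sᴴ = S := by rw [hS, diagReal_pow, conjTranspose_diagReal]
  have hDh : Dᴴ = D := by rw [hD, diagReal_pow, conjTranspose_diagReal]
  have hD'E : D' = diagReal 𝕜 (fun j => 2 * σ j ^ N * RCLike.re (P j j)) - (S * S + S * S) := by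
    rw [hD', hS, diagReal_pow]
    ext j k
    by_cases hjk : j = k
    · subst hjk
      simp only [diagReal, Matrix.sub_apply, Matrix.add_apply, Matrix.diagonal_mul_diagonal,
        Matrix.diagonal_apply_eq]
      push_cast
      ring
    · simp [diagReal, hjk]
  have hA : A * D - D * A + D' = P * S + S * Pᴴ - (S * S + S * S) := by
    rw [← h.left_commutator (by omega) hσ, hD'E]
    abel
  have hB : B * D - D * B + D' = S * P + Pᴴ * S - (S * S + S * S) := by
    rw [← h.right_commutator (by omega) hσ, hD'E]
    abel
  have hQpart := re_trace_deriv_of_commutator hQ hSh hA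
  have hRpart := re_trace_deriv_of_commutator (P := Pᴴ) hR hSh
    (by rw [hB, Matrix.conjTranspose_conjTranspose, add_comm (S * P)])
  have hPpart := re_trace_deriv_of_commutators h.skew_left h.skew_right hSh hDh hA hB
    (h.anticommutator hN hσ)
  have hskew : (P - Pᴴ)ᴴ = -(P - Pᴴ) := by simp
  rw [re_trace_weighted_mul_of_skew hskew] at hPpart
  have hRP : RCLike.re (R * Pᴴ * S).trace = RCLike.re (Q * P * S).trace := by
    rw [← re_trace_conjTranspose]
    simp only [Matrix.conjTranspose_mul, Matrix.conjTranspose_conjTranspose, hSh, hR]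
    rw [re_trace_mul_comm, hQP]
  have hsq : RCLike.re ((P - Pᴴ) * (P - Pᴴ) * S).trace =
      RCLike.re ((P + Pᴴ) * (P + Pᴴ) * S).trace -
        2 * RCLike.re ((P * Pᴴ + Pᴴ * P) * S).trace := by
    simp only [sub_mul, mul_sub, add_mul, mul_add, Matrix.trace_sub, Matrix.trace_add, map_sub,
      map_add]
    ring
  have hw : ∑ j, ∑ k, 2 * fN N (σ j) (σ k) * ‖(P - Pᴴ) j k‖ ^ 2 =
      2 * ∑ j, ∑ k, fN N (σ j) (σ k) * ‖(P - Pᴴ) j k‖ ^ 2 := by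
    simp only [Finset.mul_sum, mul_assoc]
  rw [hw] at hPpart
  rw [hRP] at hRpart
  simp only [sub_mul, add_mul, mul_sub, mul_add, Matrix.trace_sub, Matrix.trace_add, map_sub,
    map_add] at *
  linarith

section Expansion

variable {T U V : Matrix (Fin d) (Fin d) 𝕜}

lemma sqrt_mul_sqrt_of_posSemidef (hT : T.PosSemidef) : CFC.sqrt T * CFC.sqrt T = T :=
  CFC.sqrt_mul_sqrt_self T (Matrix.nonneg_iff_posSemidef.mpr hT)

lemma conjTranspose_sqrt (T : Matrix (Fin d) (Fin d) 𝕜) : (CFC.sqrt T)ᴴ = CFC.sqrt T :=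
  (Matrix.nonneg_iff_posSemidef.mp (CFC.sqrt_nonneg T)).isHermitian

lemma sqrt_mul_conjTranspose_mul_sqrt_mul (hT : T.PosSemidef) (X Y : Matrix (Fin d) (Fin d) 𝕜) :
    (CFC.sqrt T * X)ᴴ * (CFC.sqrt T * Y) = Xᴴ * T * Y := by
  rw [Matrix.conjTranspose_mul, conjTranspose_sqrt]
  conv_rhs => rw [← sqrt_mul_sqrt_of_posSemidef hT]
  simp only [mul_assoc]

/-- `re tr ((U - V)ᴴ T (U - V) diag w)`, with the two cross terms merged. -/
lemma re_trace_conj_sub_mul_diagReal (hT : T.PosSemidef) (w : Fin d → ℝ) :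
    RCLike.re ((U - V)ᴴ * T * (U - V) * diagReal 𝕜 w).trace =
      RCLike.re ((Uᴴ * T * U + Vᴴ * T * V - (Uᴴ * T * V + Uᴴ * T * V)) * diagReal 𝕜 w).trace := by
  have h := re_trace_conjTranspose_mul_of_conjTranspose_eq (conjTranspose_diagReal (𝕜 := 𝕜) w)
    (Uᴴ * T * V)
  simp only [Matrix.conjTranspose_mul, Matrix.conjTranspose_conjTranspose,
    hT.isHermitian.eq] at h
  simp only [Matrix.conjTranspose_sub, sub_mul, mul_sub, add_mul, Matrix.trace_sub,
    Matrix.trace_add, map_sub, map_add, mul_assoc] at h ⊢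
  linarith

lemma skewError_eq_re_trace (hT : T.PosSemidef) (σ : Fin d → ℝ) :
    skewError T U V σ = RCLike.re (diagReal 𝕜 (fun j => σ j ^ 2) *
      (Uᴴ * T * U + Vᴴ * T * V - (Uᴴ * T * V + Uᴴ * T * V))).trace := by
  rw [re_trace_mul_comm, ← re_trace_conj_sub_mul_diagReal hT, skewError, frobSq_eq_re_trace,
    Matrix.conjTranspose_mul, mul_assoc, ← mul_assoc _ _ (diagReal 𝕜 σ),
    sqrt_mul_conjTranspose_mul_sqrt_mul hT, re_trace_mul_comm, conjTranspose_diagReal, mul_assoc,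
    ← diagReal_pow, pow_two]

lemma skewErrorRate_eq (hT : T.PosSemidef) (hU : U ∈ Matrix.unitaryGroup (Fin d) 𝕜)
    (hV : V ∈ Matrix.unitaryGroup (Fin d) 𝕜) (N : ℕ) (σ : Fin d → ℝ)
    {P Q R : Matrix (Fin d) (Fin d) 𝕜}
    (hP : P = Uᴴ * T * V) (hQ : Q = Uᴴ * T * U) (hR : R = Vᴴ * T * V) :
    skewErrorRate N T U V σ =
      -(2 * RCLike.re ((P * Pᴴ + Pᴴ * P - (Q * P + Q * P)) * diagReal 𝕜 σ ^ N).trace)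
        - 2 * RCLike.re ((Q + R - (P + P)) * (diagReal 𝕜 σ ^ N * diagReal 𝕜 σ ^ N)).trace
        - ∑ j, ∑ k, fN N (σ j) (σ k) * ‖(P - Pᴴ) j k‖ ^ 2 := by
  have hU' : U * Uᴴ = 1 := Matrix.mem_unitaryGroup_iff.mp hU
  have hV' : V * Vᴴ = 1 := Matrix.mem_unitaryGroup_iff.mp hV
  have hTh : Tᴴ = T := hT.isHermitian.eq
  have hcol : ∀ j, primedCol T U j - primedCol T V j = (CFC.sqrt T * (U - V)).col j := by
    intro j
    ext i
    simp [primedCol, mul_sub]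
  have hcol' : ∀ j, CFC.sqrt T *ᵥ (primedCol T U j - primedCol T V j) = (T * (U - V)).col j := by
    intro j
    rw [hcol]
    conv_rhs => rw [← sqrt_mul_sqrt_of_posSemidef hT, mul_assoc]
    ext i
    simp [Matrix.mulVec, dotProduct, Matrix.mul_apply]
  have hdot : ∀ j k, star (primedCol T U j) ⬝ᵥ primedCol T V k
      - star (primedCol T V j) ⬝ᵥ primedCol T U k = (P - Pᴴ) j k := by
    have hd : ∀ X Y : Matrix (Fin d) (Fin d) 𝕜, ∀ j k,
        star (primedCol T X j) ⬝ᵥ primedCol T Y k = (Xᴴ * T * Y) j k := by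
      intro X Y j k
      rw [← sqrt_mul_conjTranspose_mul_sqrt_mul hT]
      rfl
    intro j k
    rw [hd, hd, hP]
    simp only [Matrix.conjTranspose_mul, Matrix.conjTranspose_conjTranspose, hTh,
      Matrix.sub_apply, mul_assoc]
  have hmul : ∀ (X Y Z : Matrix (Fin d) (Fin d) 𝕜), Y * Yᴴ = 1 → ∀ Z' : Matrix (Fin d) (Fin d) 𝕜,
      Xᴴ * T * Y * (Yᴴ * T * Z) * Z' = Xᴴ * (T * T) * Z * Z' := by
    intro X Y Z hY Z'
    calc Xᴴ * T * Y * (Yᴴ * T * Z) * Z' = Xᴴ * T * (Y * Yᴴ) * T * Z * Z' := by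
          simp only [mul_assoc]
      _ = _ := by rw [hY]; simp only [mul_assoc, mul_one]
  have h1 : ∑ j, σ j ^ N *
      ‖WithLp.toLp 2 (CFC.sqrt T *ᵥ (primedCol T U j - primedCol T V j))‖ ^ 2 =
      RCLike.re ((P * Pᴴ + Pᴴ * P - (Q * P + Q * P)) * diagReal 𝕜 σ ^ N).trace := by
    simp only [hcol']
    rw [sum_mul_norm_col_sq (T * (U - V)) fun j => σ j ^ N, diagReal_pow]
    have hTT : (T * T).PosSemidef := by
      have := Matrix.posSemidef_conjTranspose_mul_self T
      rwa [hTh] at this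
    have e : (T * (U - V))ᴴ * (T * (U - V)) = (U - V)ᴴ * (T * T) * (U - V) := by
      rw [Matrix.conjTranspose_mul, hTh]
      simp only [mul_assoc]
    rw [e, re_trace_conj_sub_mul_diagReal hTT]
    have hPh : Pᴴ = Vᴴ * T * U := by
      rw [hP]
      simp only [Matrix.conjTranspose_mul, Matrix.conjTranspose_conjTranspose, hTh, mul_assoc]
    rw [hPh, hP, hQ]
    simp only [sub_mul, add_mul, hmul _ _ _ hU', hmul _ _ _ hV']
  have h2 : ∑ j, σ j ^ (2 * N) * ‖WithLp.toLp 2 (primedCol T U j - primedCol T V j)‖ ^ 2 =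
      RCLike.re ((Q + R - (P + P)) * (diagReal 𝕜 σ ^ N * diagReal 𝕜 σ ^ N)).trace := by
    simp only [hcol]
    rw [sum_mul_norm_col_sq (CFC.sqrt T * (U - V)) fun j => σ j ^ (2 * N),
      sqrt_mul_conjTranspose_mul_sqrt_mul hT, re_trace_conj_sub_mul_diagReal hT, ← pow_add,
      diagReal_pow, two_mul N, hP, hQ, hR]
  rw [skewErrorRate, h1, h2]
  simp only [hdot]

end Expansion

lemma skewErrorRate_nonpos {N : ℕ} (hN : 2 ≤ N) (T U V : Matrix (Fin d) (Fin d) 𝕜)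
    {σ : Fin d → ℝ} (hσ : ∀ j, 0 ≤ σ j) : skewErrorRate N T U V σ ≤ 0 := by
  have h1 : 0 ≤ ∑ j, σ j ^ N *
      ‖WithLp.toLp 2 (CFC.sqrt T *ᵥ (primedCol T U j - primedCol T V j))‖ ^ 2 :=
    Finset.sum_nonneg fun j _ => mul_nonneg (pow_nonneg (hσ j) _) (sq_nonneg _)
  have h2 : 0 ≤ ∑ j, σ j ^ (2 * N) *
      ‖WithLp.toLp 2 (primedCol T U j - primedCol T V j)‖ ^ 2 :=
    Finset.sum_nonneg fun j _ => mul_nonneg (pow_nonneg (hσ j) _) (sq_nonneg _)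
  have h3 : 0 ≤ ∑ j, ∑ k, fN N (σ j) (σ k) *
      ‖star (primedCol T U j) ⬝ᵥ primedCol T V k
        - star (primedCol T V j) ⬝ᵥ primedCol T U k‖ ^ 2 :=
    Finset.sum_nonneg fun j _ => Finset.sum_nonneg fun k _ =>
      mul_nonneg (fN_nonneg hN (hσ j) (hσ k)) (sq_nonneg _)
  rw [skewErrorRate]
  linarith

/-! ### The flow along an analytic singular value decomposition -/

lemma conj_pow_of_mem_unitaryGroup {U : Matrix (Fin d) (Fin d) 𝕜}
    (hU : U ∈ Matrix.unitaryGroup (Fin d) 𝕜) (D : Matrix (Fin d) (Fin d) 𝕜) (n : ℕ) :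
    (U * D * Uᴴ) ^ n = U * D ^ n * Uᴴ := by
  have h1 : U * Uᴴ = 1 := Matrix.mem_unitaryGroup_iff.mp hU
  have h2 : Uᴴ * U = 1 := Matrix.mem_unitaryGroup_iff'.mp hU
  induction n with
  | zero => simp [h1]
  | succ n ih =>
    rw [pow_succ, ih, pow_succ]
    calc U * D ^ n * Uᴴ * (U * D * Uᴴ) = U * D ^ n * (Uᴴ * U) * D * Uᴴ := by
          simp only [mul_assoc]
      _ = U * (D ^ n * D) * Uᴴ := by rw [h2, mul_one]; simp only [mul_assoc]

lemma posSemidef_conj_diagReal_sq (U : Matrix (Fin d) (Fin d) 𝕜) (σ : Fin d → ℝ) :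
    (U * diagReal 𝕜 σ ^ 2 * Uᴴ).PosSemidef := by
  have h := Matrix.posSemidef_self_mul_conjTranspose (U * diagReal 𝕜 σ)
  rwa [Matrix.conjTranspose_mul, conjTranspose_diagReal, ← mul_assoc, mul_assoc U, ← pow_two] at h

lemma IsBalanced.last_mul_conjTranspose_eq {N : ℕ} (hN : N ≠ 0)
    {W : ℕ → Matrix (Fin d) (Fin d) 𝕜} (h : IsBalanced N W) {U V : Matrix (Fin d) (Fin d) 𝕜}
    {σ : Fin d → ℝ} (hU : U ∈ Matrix.unitaryGroup (Fin d) 𝕜)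
    (hV : V ∈ Matrix.unitaryGroup (Fin d) 𝕜) (hW : layerProd W N = U * diagReal 𝕜 σ ^ N * Vᴴ) :
    W N * (W N)ᴴ = U * diagReal 𝕜 σ ^ 2 * Uᴴ := by
  have hV' : Vᴴ * V = 1 := Matrix.mem_unitaryGroup_iff'.mp hV
  refine eq_of_pow_eq_pow_of_posSemidef (Matrix.posSemidef_self_mul_conjTranspose _)
    (posSemidef_conj_diagReal_sq U σ) hN ?_
  rw [← h.layerProd_mul_conjTranspose, hW, conj_pow_of_mem_unitaryGroup hU, ← pow_mul, mul_comm 2 N,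
    pow_mul, pow_two]
  simp only [Matrix.conjTranspose_mul, Matrix.conjTranspose_conjTranspose,
    Matrix.conjTranspose_pow, conjTranspose_diagReal]
  calc U * diagReal 𝕜 σ ^ N * Vᴴ * (V * (diagReal 𝕜 σ ^ N * Uᴴ))
      = U * diagReal 𝕜 σ ^ N * (Vᴴ * V) * (diagReal 𝕜 σ ^ N * Uᴴ) := by simp only [mul_assoc]
    _ = _ := by rw [hV', mul_one]; simp only [mul_assoc]

lemma IsBalanced.conjTranspose_mul_first_eq {N : ℕ} (hN : N ≠ 0)
    {W : ℕ → Matrix (Fin d) (Fin d) 𝕜} (h : IsBalanced N W) {U V : Matrix (Fin d) (Fin d) 𝕜}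
    {σ : Fin d → ℝ} (hU : U ∈ Matrix.unitaryGroup (Fin d) 𝕜)
    (hV : V ∈ Matrix.unitaryGroup (Fin d) 𝕜) (hW : layerProd W N = U * diagReal 𝕜 σ ^ N * Vᴴ) :
    (W 1)ᴴ * W 1 = V * diagReal 𝕜 σ ^ 2 * Vᴴ := by
  have hU' : Uᴴ * U = 1 := Matrix.mem_unitaryGroup_iff'.mp hU
  refine eq_of_pow_eq_pow_of_posSemidef (Matrix.posSemidef_conjTranspose_mul_self _)
    (posSemidef_conj_diagReal_sq V σ) hN ?_
  rw [← h.conjTranspose_mul_layerProd, hW, conj_pow_of_mem_unitaryGroup hV, ← pow_mul, mul_comm 2 N,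
    pow_mul, pow_two]
  simp only [Matrix.conjTranspose_mul, Matrix.conjTranspose_conjTranspose,
    Matrix.conjTranspose_pow, conjTranspose_diagReal]
  calc V * (diagReal 𝕜 σ ^ N * Uᴴ) * (U * diagReal 𝕜 σ ^ N * Vᴴ)
      = V * diagReal 𝕜 σ ^ N * (Uᴴ * U) * (diagReal 𝕜 σ ^ N * Vᴴ) := by simp only [mul_assoc]
    _ = _ := by rw [hU', mul_one]; simp only [mul_assoc]

lemma exists_hasEntryDerivWithinAt {M : ℝ → Matrix (Fin d) (Fin d) 𝕜} {s : Set ℝ} {t : ℝ}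
    (h : ∀ i j, AnalyticOn ℝ (fun τ => M τ i j) s) (ht : t ∈ s) :
    ∃ M', HasEntryDerivWithinAt M M' s t :=
  ⟨Matrix.of fun i j => derivWithin (fun τ => M τ i j) s t, fun i j =>
    ((h i j).differentiableOn t ht).hasDerivWithinAt⟩

lemma hasEntryDerivWithinAt_diagReal {σ : ℝ → Fin d → ℝ} {ds : Fin d → ℝ} {s : Set ℝ} {t : ℝ}
    (h : ∀ j, HasDerivWithinAt (fun τ => σ τ j) (ds j) s t) :
    HasEntryDerivWithinAt (fun τ => diagReal 𝕜 (σ τ)) (diagReal 𝕜 ds) s t := by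
  intro i j
  by_cases hij : i = j
  · subst hij
    simp only [diagReal, Matrix.diagonal_apply_eq]
    exact (RCLike.ofRealCLM (K := 𝕜)).hasFDerivAt.comp_hasDerivWithinAt t (h i)
  · simpa [diagReal, hij] using hasDerivWithinAt_const t s (0 : 𝕜)

lemma conjTranspose_mul_deriv_of_unitary {U : ℝ → Matrix (Fin d) (Fin d) 𝕜}
    {U' : Matrix (Fin d) (Fin d) 𝕜} {t : ℝ} (ht : t ∈ Ici (0 : ℝ))
    (hU : ∀ τ ∈ Ici (0 : ℝ), U τ ∈ Matrix.unitaryGroup (Fin d) 𝕜)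
    (h : HasEntryDerivWithinAt U U' (Ici 0) t) :
    ((U t)ᴴ * U')ᴴ = -((U t)ᴴ * U') := by
  have h1 : HasEntryDerivWithinAt (fun τ => (U τ)ᴴ * U τ) 0 (Ici 0) t :=
    (HasEntryDerivWithinAt.const 1).congr
      (fun τ hτ => Matrix.mem_unitaryGroup_iff'.mp (hU τ hτ)) ht
  have h2 := (h.conjTranspose.mul h).unique h1 (uniqueDiffOn_Ici 0 t ht)
  rw [Matrix.conjTranspose_mul, Matrix.conjTranspose_conjTranspose]
  exact eq_neg_of_add_eq_zero_left h2

section Flow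

variable {N : ℕ} {T : Matrix (Fin d) (Fin d) 𝕜} {a : ℝ} {W : ℝ → ℕ → Matrix (Fin d) (Fin d) 𝕜}
  {U V : ℝ → Matrix (Fin d) (Fin d) 𝕜} {σ : ℝ → Fin d → ℝ}

lemma IsNonnegASVD.isFrameFlow (hN : 0 < N) (ha : 0 ≤ a) (hflow : IsGradientFlow N T a W)
    (hbal : IsBalanced N (W 0)) (hsvd : IsNonnegASVD N (fun t => layerProd (W t) N) U V σ)
    {t : ℝ} (ht : t ∈ Ici (0 : ℝ)) {U' V' : Matrix (Fin d) (Fin d) 𝕜} {ds : Fin d → ℝ}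
    (hU : HasEntryDerivWithinAt U U' (Ici 0) t) (hV : HasEntryDerivWithinAt V V' (Ici 0) t)
    (hs : ∀ j, HasDerivWithinAt (fun τ => σ τ j ^ N) (ds j) (Ici 0) t) :
    IsFrameFlow N ((U t)ᴴ * U') ((V t)ᴴ * V') ((U t)ᴴ * T * V t) (σ t) ds := by
  have hUt := hsvd.unitary_left t ht
  have hVt := hsvd.unitary_right t ht
  have hU1 : (U t)ᴴ * U t = 1 := Matrix.mem_unitaryGroup_iff'.mp hUt
  have hV1 : (V t)ᴴ * V t = 1 := Matrix.mem_unitaryGroup_iff'.mp hVt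
  have hskewV := conjTranspose_mul_deriv_of_unitary ht hsvd.unitary_right hV
  refine ⟨conjTranspose_mul_deriv_of_unitary ht hsvd.unitary_left hU, hskewV, ?_⟩
  have hb := hflow.isBalanced hN ha hbal ht
  have hdec : layerProd (W t) N = U t * diagReal 𝕜 (σ t) ^ N * (V t)ᴴ := hsvd.decomp t ht
  have h1 : HasEntryDerivWithinAt (fun τ => U τ * diagReal 𝕜 (fun j => σ τ j ^ N) * (V τ)ᴴ)
      _ (Ici 0) t := (hU.mul (hasEntryDerivWithinAt_diagReal hs)).mul hV.conjTranspose
  have h2 := (h1.congr (L := fun τ => layerProd (W τ) N)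
    (fun τ hτ => by rw [hsvd.decomp τ hτ, diagReal_pow]) ht).unique
    (hflow.hasEntryDerivWithinAt_layerProd hN ha hbal ht) (uniqueDiffOn_Ici 0 t ht)
  rw [hb.last_mul_conjTranspose_eq hN.ne' hUt hVt hdec,
    hb.conjTranspose_mul_first_eq hN.ne' hUt hVt hdec, hdec, ← diagReal_pow] at h2
  simp only [conj_pow_of_mem_unitaryGroup hUt, conj_pow_of_mem_unitaryGroup hVt] at h2
  set S := diagReal 𝕜 (σ t) ^ N
  set D := diagReal 𝕜 (σ t) ^ 2
  have hleft : (U t)ᴴ * ((U' * S + U t * diagReal 𝕜 ds) * (V t)ᴴ + U t * S * V'ᴴ) * V t =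
      (U t)ᴴ * U' * S - S * ((V t)ᴴ * V') + diagReal 𝕜 ds := by
    have hVV : V'ᴴ * V t = -((V t)ᴴ * V') := by
      rw [← hskewV, Matrix.conjTranspose_mul, Matrix.conjTranspose_conjTranspose]
    calc _ = (U t)ᴴ * U' * S * ((V t)ᴴ * V t) +
          ((U t)ᴴ * U t) * diagReal 𝕜 ds * ((V t)ᴴ * V t) +
          ((U t)ᴴ * U t) * S * (V'ᴴ * V t) := by
          simp only [mul_add, add_mul, mul_assoc]
      _ = _ := by
          rw [hU1, hV1, hVV]
          simp only [mul_one, one_mul, mul_neg]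
          abel
  rw [← hleft, h2, Finset.mul_sum, Finset.sum_mul]
  refine Finset.sum_congr rfl fun l _ => ?_
  calc _ = ((U t)ᴴ * U t) * D ^ (N - 1 - l) *
        ((U t)ᴴ * T * V t - ((U t)ᴴ * U t) * S * ((V t)ᴴ * V t)) * D ^ l * ((V t)ᴴ * V t) := by
        simp only [mul_sub, sub_mul, mul_assoc]
    _ = _ := by
        rw [hU1, hV1]
        simp only [mul_one, one_mul]

lemma HasEntryDerivWithinAt.continuousWithinAt_re_apply {M : ℝ → Matrix (Fin d) (Fin d) 𝕜}
    {M' : Matrix (Fin d) (Fin d) 𝕜} {s : Set ℝ} {t : ℝ} (h : HasEntryDerivWithinAt M M' s t)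
    (i j : Fin d) : ContinuousWithinAt (fun τ => RCLike.re (M τ i j)) s t :=
  RCLike.continuous_re.continuousAt.comp_continuousWithinAt (h i j).continuousWithinAt

/-- A singular value of `W` that is positive initially stays positive: `s = σ ^ N` solves
`s' = N σ^(N-2) (re P_jj - s) s`, a linear equation with locally bounded coefficient. -/
lemma IsNonnegASVD.pos (hN : 2 ≤ N) (ha : 0 ≤ a) (hflow : IsGradientFlow N T a W)
    (hbal : IsBalanced N (W 0)) (hsvd : IsNonnegASVD N (fun t => layerProd (W t) N) U V σ)
    (hnonzero : ∀ j, σ 0 j ^ N ≠ 0) {t : ℝ} (ht : t ∈ Ici (0 : ℝ)) (j : Fin d) : 0 < σ t j := by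
  have hN0 : N ≠ 0 := by omega
  set g : ℝ → ℝ := fun τ =>
    N * σ τ j ^ (N - 2) * (RCLike.re (((U τ)ᴴ * T * V τ) j j) - σ τ j ^ N) with hg
  have hder : ∀ τ ∈ Ici (0 : ℝ),
      HasDerivWithinAt (fun τ => σ τ j ^ N) (g τ * σ τ j ^ N) (Ici 0) τ := by
    intro τ hτ
    obtain ⟨U', hU⟩ := exists_hasEntryDerivWithinAt hsvd.analytic_left hτ
    obtain ⟨V', hV⟩ := exists_hasEntryDerivWithinAt hsvd.analytic_right hτ
    have hs : ∀ k, HasDerivWithinAt (fun τ => σ τ k ^ N)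
        (derivWithin (fun τ => σ τ k ^ N) (Ici 0) τ) (Ici 0) τ := fun k =>
      ((hsvd.analytic_diag k).differentiableOn τ hτ).hasDerivWithinAt
    refine (hs j).congr_deriv ?_
    rw [(hsvd.isFrameFlow (by omega) ha hflow hbal hτ hU hV hs).velocity_eq j, hg]
    obtain ⟨n, rfl⟩ : ∃ n, N = n + 2 := ⟨N - 2, by omega⟩
    rw [show n + 2 - 1 = n + 1 by omega, Nat.add_sub_cancel]
    ring
  have hgc : ContinuousOn g (Icc 0 t) := by
    have hsc : ContinuousOn (fun τ => σ τ j) (Ici 0) := by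
      have h1 : ContinuousOn (fun τ => (σ τ j ^ N) ^ ((N : ℝ)⁻¹)) (Ici 0) :=
        (hsvd.analytic_diag j).continuousOn.rpow_const fun τ _ => Or.inr (by positivity)
      exact h1.congr fun τ hτ => (Real.pow_rpow_inv_natCast (hsvd.nonneg τ hτ j) hN0).symm
    have hPc : ContinuousOn (fun τ => RCLike.re (((U τ)ᴴ * T * V τ) j j)) (Ici 0) := by
      intro τ hτ
      obtain ⟨U', hU⟩ := exists_hasEntryDerivWithinAt hsvd.analytic_left hτ
      obtain ⟨V', hV⟩ := exists_hasEntryDerivWithinAt hsvd.analytic_right hτ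
      exact ((hU.conjTranspose.mul (.const T)).mul hV).continuousWithinAt_re_apply j j
    exact ((continuousOn_const.mul (hsc.pow _)).mul (hPc.sub (hsc.pow _))).mono Icc_subset_Ici_self
  obtain ⟨C, hC⟩ := isCompact_Icc.bddBelow_image hgc
  -- With `C` a lower bound of the coefficient on `[0, t]`, `s e^{-Cτ}` is monotone there.
  have hmono : MonotoneOn (fun τ => σ τ j ^ N * Real.exp (-C * τ)) (Icc 0 t) := by
    have hd : ∀ τ ∈ Icc 0 t, HasDerivWithinAt (fun τ => σ τ j ^ N * Real.exp (-C * τ))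
        ((g τ - C) * (σ τ j ^ N * Real.exp (-C * τ))) (Icc 0 t) τ := by
      intro τ hτ
      have he : HasDerivAt (fun τ => Real.exp (-C * τ)) (Real.exp (-C * τ) * -C) τ := by
        simpa using ((hasDerivAt_id τ).const_mul (-C)).exp
      refine (((hder τ hτ.1).mono Icc_subset_Ici_self).mul he.hasDerivWithinAt).congr_deriv ?_
      ring
    refine monotoneOn_of_hasDerivWithinAt_nonneg (convex_Icc 0 t)
      (fun τ hτ => (hd τ hτ).continuousWithinAt)
      (fun τ hτ => (hd τ (interior_subset hτ)).mono interior_subset) fun τ hτ => ?_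
    have hτ' := interior_subset hτ
    exact mul_nonneg (sub_nonneg.mpr (hC (mem_image_of_mem g hτ')))
      (mul_nonneg (pow_nonneg (hsvd.nonneg τ hτ'.1 j) N) (Real.exp_pos _).le)
  have h0 : 0 < σ 0 j ^ N :=
    lt_of_le_of_ne (pow_nonneg (hsvd.nonneg 0 self_mem_Ici j) N) (hnonzero j).symm
  have hle := hmono (left_mem_Icc.mpr ht) (right_mem_Icc.mpr ht) ht
  simp only [mul_zero, Real.exp_zero, mul_one] at hle
  refine lt_of_le_of_ne (hsvd.nonneg t ht j) fun hz => ?_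
  rw [← hz, zero_pow hN0, zero_mul] at hle
  linarith

/-- The evolution of `Σ_w²`, obtained from that of the singular values by taking the root of order
`N / 2`; this needs the singular value to be positive. -/
lemma hasDerivWithinAt_sq_of_pow (hN : 0 < N) {ρ : ℝ → ℝ} {r t : ℝ} (ht : t ∈ Ici (0 : ℝ))
    (hnn : ∀ τ ∈ Ici (0 : ℝ), 0 ≤ ρ τ) (hpos : 0 < ρ t)
    (h : HasDerivWithinAt (fun τ => ρ τ ^ N) (N * (ρ t ^ 2) ^ (N - 1) * r) (Ici 0) t) :
    HasDerivWithinAt (fun τ => ρ τ ^ 2) (2 * ρ t ^ N * r) (Ici 0) t := by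
  have hNr : (N : ℝ) ≠ 0 := by exact_mod_cast hN.ne'
  have hroot : ∀ x : ℝ, 0 ≤ x → (x ^ N) ^ ((2 : ℝ) / N) = x ^ 2 := fun x hx => by
    rw [← Real.rpow_natCast x N, ← Real.rpow_mul hx, mul_div_cancel₀ _ hNr, Real.rpow_two]
  have h1 := h.rpow_const (p := (2 : ℝ) / N) (Or.inl (pow_pos hpos N).ne')
  refine (h1.congr_deriv ?_).congr (fun τ hτ => (hroot _ (hnn τ hτ)).symm)
    (hroot _ (hnn t ht)).symm
  rw [Real.rpow_sub_one (pow_pos hpos N).ne', hroot _ hpos.le]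
  have e : (ρ t ^ 2) ^ (N - 1) * ρ t ^ 2 = ρ t ^ N * ρ t ^ N := by
    rw [← pow_succ, Nat.sub_add_cancel hN, ← pow_add, ← pow_mul, two_mul]
  field_simp
  linear_combination r * e

lemma hasDerivWithinAt_skewError (hN : 2 ≤ N) (hT : T.PosSemidef) (ha : 0 ≤ a)
    (hflow : IsGradientFlow N T a W) (hbal : IsBalanced N (W 0))
    (hsvd : IsNonnegASVD N (fun t => layerProd (W t) N) U V σ)
    (hnonzero : ∀ j, σ 0 j ^ N ≠ 0) {t : ℝ} (ht : t ∈ Ici (0 : ℝ)) :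
    HasDerivWithinAt (fun τ => skewError T (U τ) (V τ) (σ τ))
      (skewErrorRate N T (U t) (V t) (σ t)) (Ici 0) t := by
  have hσ : ∀ j, 0 < σ t j := hsvd.pos hN ha hflow hbal hnonzero ht
  have hTh : Tᴴ = T := hT.isHermitian.eq
  have hU1 : U t * (U t)ᴴ = 1 := Matrix.mem_unitaryGroup_iff.mp (hsvd.unitary_left t ht)
  have hV1 : V t * (V t)ᴴ = 1 := Matrix.mem_unitaryGroup_iff.mp (hsvd.unitary_right t ht)
  obtain ⟨U', hU⟩ := exists_hasEntryDerivWithinAt hsvd.analytic_left ht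
  obtain ⟨V', hV⟩ := exists_hasEntryDerivWithinAt hsvd.analytic_right ht
  have hs : ∀ k, HasDerivWithinAt (fun τ => σ τ k ^ N)
      (derivWithin (fun τ => σ τ k ^ N) (Ici 0) t) (Ici 0) t := fun k =>
    ((hsvd.analytic_diag k).differentiableOn t ht).hasDerivWithinAt
  have hframe := hsvd.isFrameFlow (by omega) ha hflow hbal ht hU hV hs
  have hD := hasEntryDerivWithinAt_diagReal (𝕜 := 𝕜) fun j =>
    hasDerivWithinAt_sq_of_pow (by omega) ht (fun τ hτ => hsvd.nonneg τ hτ j) (hσ j)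
      ((hs j).congr_deriv (hframe.velocity_eq j))
  -- The derivative of `Xᴴ T Y` in terms of the frame velocities `Xᴴ X'` and `Yᴴ Y'`.
  have hconj : ∀ {X Y : ℝ → Matrix (Fin d) (Fin d) 𝕜} {X' Y' : Matrix (Fin d) (Fin d) 𝕜},
      HasEntryDerivWithinAt X X' (Ici 0) t → HasEntryDerivWithinAt Y Y' (Ici 0) t →
      X t * (X t)ᴴ = 1 → Y t * (Y t)ᴴ = 1 → ((X t)ᴴ * X')ᴴ = -((X t)ᴴ * X') →
      HasEntryDerivWithinAt (fun τ => (X τ)ᴴ * T * Y τ)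
        ((X t)ᴴ * T * Y t * ((Y t)ᴴ * Y') - (X t)ᴴ * X' * ((X t)ᴴ * T * Y t)) (Ici 0) t := by
    intro X Y X' Y' hX hY hX1 hY1 hXs
    refine ((hX.conjTranspose.mul (.const T)).mul hY).congr_deriv ?_
    have e : X'ᴴ = -((X t)ᴴ * X') * (X t)ᴴ := by
      rw [← hXs, Matrix.conjTranspose_mul, Matrix.conjTranspose_conjTranspose, mul_assoc, hX1,
        mul_one]
    have e2 : (X t)ᴴ * T * Y t * ((Y t)ᴴ * Y') = (X t)ᴴ * T * (Y t * (Y t)ᴴ) * Y' := by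
      simp only [mul_assoc]
    rw [e2, hY1, e, mul_zero, add_zero, mul_one]
    simp only [neg_mul, mul_assoc]
    abel
  have hQ := hconj hU hU hU1 hU1 hframe.skew_left
  have hR := hconj hV hV hV1 hV1 hframe.skew_right
  have hP := hconj hU hV hU1 hV1 hframe.skew_left
  have hder := (hD.mul ((hQ.add hR).sub (hP.add hP))).re_trace
  simp only [skewError_eq_re_trace hT]
  refine hder.congr_deriv ?_
  rw [skewErrorRate_eq hT (hsvd.unitary_left t ht) (hsvd.unitary_right t ht) N (σ t) rfl rfl rfl,
    ← hframe.re_trace_deriv hN hσ (by simp [hTh, mul_assoc]) (by simp [hTh, mul_assoc]) ?_,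
    diagReal_pow]
  calc (U t)ᴴ * T * U t * ((U t)ᴴ * T * V t) = (U t)ᴴ * T * (U t * (U t)ᴴ) * T * V t := by
        simp only [mul_assoc]
    _ = (U t)ᴴ * T * (V t * (V t)ᴴ) * T * V t := by rw [hU1, hV1]
    _ = _ := by simp only [mul_assoc]

end Flow

end DeepMF

theorem mainTheorem7 {𝕜 : Type*} [RCLike 𝕜] {d N : ℕ} (hN : 2 ≤ N)
    (T : Matrix (Fin d) (Fin d) 𝕜) (hT : T.PosSemidef) (a : ℝ) (ha : 0 ≤ a)
    (W : ℝ → ℕ → Matrix (Fin d) (Fin d) 𝕜)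
    (hflow : DeepMF.IsGradientFlow N T a W)
    (hbal : DeepMF.IsBalanced N (W 0))
    (U V : ℝ → Matrix (Fin d) (Fin d) 𝕜) (σ : ℝ → Fin d → ℝ)
    (hsvd : DeepMF.IsNonnegASVD N (fun t => DeepMF.layerProd (W t) N) U V σ)
    (hdistinct : ∀ j k, j ≠ k → σ 0 j ^ N ≠ σ 0 k ^ N)
    (hnonzero : ∀ j, σ 0 j ^ N ≠ 0) :
    (∀ t ∈ Set.Ici (0 : ℝ),
      HasDerivWithinAt (fun s => DeepMF.skewError T (U s) (V s) (σ s))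
        (DeepMF.skewErrorRate N T (U t) (V t) (σ t)) (Set.Ici 0) t ∧
      DeepMF.skewErrorRate N T (U t) (V t) (σ t) ≤ 0) ∧
    AntitoneOn (fun t => DeepMF.skewError T (U t) (V t) (σ t)) (Set.Ici 0) ∧
    (∀ x y : ℝ, 0 ≤ x → 0 ≤ y → 0 ≤ DeepMF.fN N x y) ∧
    ContinuousOn (fun p : ℝ × ℝ => DeepMF.fN N p.1 p.2) (Set.Ici 0 ×ˢ Set.Ici 0) ∧
    AnalyticOn ℝ (fun p : ℝ × ℝ => DeepMF.fN N p.1 p.2)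
      ((Set.Ici 0 ×ˢ Set.Ici 0) \ {(0, 0)}) ∧
    (Even N → AnalyticOn ℝ (fun p : ℝ × ℝ => DeepMF.fN N p.1 p.2)
      (Set.Ici 0 ×ˢ Set.Ici 0)) := by
  have hderiv := fun t (ht : t ∈ Ici (0 : ℝ)) =>
    DeepMF.hasDerivWithinAt_skewError hN hT ha hflow hbal hsvd hnonzero ht
  have hrate := fun t (ht : t ∈ Ici (0 : ℝ)) =>
    DeepMF.skewErrorRate_nonpos hN T (U t) (V t) (hsvd.nonneg t ht)
  refine ⟨fun t ht => ⟨hderiv t ht, hrate t ht⟩, ?_, fun x y hx hy => DeepMF.fN_nonneg hN hx hy,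
    DeepMF.continuousOn_fN hN, DeepMF.analyticOn_fN hN, DeepMF.analyticOn_fN_of_even hN⟩
  exact antitoneOn_of_hasDerivWithinAt_nonpos (convex_Ici 0)
    (fun t ht => (hderiv t ht).continuousWithinAt)
    (fun t ht => (hderiv t (interior_subset ht)).mono interior_subset)
    fun t ht => hrate t (interior_subset ht)
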